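/- \textbf{Setting.} For finite types $\sigma$ (built from $0$ by $\to$), let $\mathbf F(0)=\mathbb N$ and let $\mathbf F(\sigma_1,\dots,\sigma_n\to0)$ be the set of all functions $\mathbf F(\sigma_1)\times\dots\times\mathbf F(\sigma_n)\to\mathbb N$; let $\mathbf P(\sigma)$ be defined in the same way with values in $\mathbb N\cup\{\bot\}$ (partial functionals with total arguments), ordered by extension $\preceq$. Terms are built from typed variables of rank $\le 3$, $0$, successor, predecessor, definition by cases on a number (only the selected branch has to be defined), application, $\lambda x.t$ (of rank $\le 3$) and $\mu x.t$ (of rank $\le 3$). They are interpreted as partial functionals, monotone in the values of the free variables: an application $ts$ is nowhere defined unless $s$ is total, and $\mu x.t$ is the least fixed point. A partial functional $\psi$ is \emph{computable in} $\phi_1,\dots,\phi_n$ if $\psi\preceq[[s(\phi_1,\dots,\phi_n)]]$ for some term $s$. Kleene's $\exists^2$ is the type $2$ functional with $\exists^2(f)=0$ if $(\exists n)(f(n)=0)$ and $\exists^2(f)=1$ otherwise; `modulo $\exists^2$' means that $\exists^2$ is added to the list of functionals in which one computes. Real numbers are coded by fast converging Cauchy sequences of rationals, finite sequences of type $1$ objects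 by type $1$ objects, and sets and functions into $\mathbb N$ by type $2$ objects that are extensional on the codes of points. A functional given by a description stands for the class of all partial functionals that are defined exactly on the described inputs and have the described outputs there. Let $D$ be any of the domains $\mathbb N^{\mathbb N}$, $2^{\mathbb N}$, $[0,1]$, $\mathbb R$. For $X\subseteq D$, $\Omega_1(X)$ is defined if $X=\{p\}$, and outputs $p$; $\Omega(X)$ is defined if $|X|\le1$, and outputs a finite sequence that includes all elements of $X$. A partial functional is in the $\Omega$-cluster (resp. the $\Omega_1$-cluster) if, modulo $\exists^2$, it computes some functional in the class $\Omega$ (resp. $\Omega_1$) and is computable in every functional in that class. A class of functionals is in a cluster if, modulo $\exists^2$, each of its elements computes some functional in the class $\Omega$ (resp. $\Omega_1$), and at least one of its elements belongs to the cluster. For $X\subseteq[0,1]$, the functionals $\Omega_n$, $\Omega_{\le n}$, $\Omega_{\mathsf{fin}}$ are defined if $|X|=n$, if $|X|\le n$, if $X$ is finite, respectively, and output a finite sequence in $[0,1]$ that includes all elements of $X$; $\Omega_{\#,\mathsf{fin}}$ and $\Omega_{\ge\#,\mathsf{fin}}$ are defined if $X$ is finite, and output $|X|$, respectively some $n\ge|X|$.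 An enumeration functional (resp. an $\Omega_{\mathsf{BW}}$-functional) takes as input $A\subseteq[0,1]$ and $Y:[0,1]\to\mathbb N$ injective on $A$, and outputs an enumeration of $A$ (a sequence whose terms are exactly the elements of $A$; for $A=\emptyset$ the special null sequence) (resp. $\sup A$, taken in $[0,1]$, so that $\sup\emptyset=0$). The weak versions are defined only if $Y$ moreover maps $A$ onto $\mathbb N$. \textbf{Theorem} (First cluster theorem). For each of these choices of $D$: \begin{itemize} \item The $\Omega_1$-cluster contains $\Omega_n$ for each $n\ge1$, a weak enumeration functional, and the weak $\Omega_{\mathsf{BW}}$-functional. \item The $\Omega$-cluster contains $\Omega_{\mathsf{fin}}$, $\Omega_{\le n}$ for each $n\ge1$, $\Omega_{\#,\mathsf{fin}}$, $\Omega_{\ge\#,\mathsf{fin}}$, an enumeration functional, and $\Omega_{\mathsf{BW}}$. \end{itemize} -/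

import Mathlib

namespace HigherType

/-! ### Finite types, total objects and partial objects -/

/-- Finite types, in curried form: `(σ₁, …, σₙ → 0)` is `σ₁ ⇒ (σ₂ ⇒ ⋯ (σₙ ⇒ 0))`. -/
inductive Ty : Type
  | nat : Ty
  | arr : Ty → Ty → Ty

infixr:60 " ⇒ " => Ty.arr

/-- The rank of a type; for `σ = (σ₁, …, σₙ → 0)` with `n ≥ 1` it is `max (rank σᵢ + 1)`. -/
def Ty.rank : Ty → ℕ
  | .nat => 0
  | .arr σ τ => max (σ.rank + 1) τ.rank

/-- The pure types `1` and `2`. -/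
abbrev Ty.one : Ty := Ty.nat ⇒ Ty.nat
abbrev Ty.two : Ty := Ty.one ⇒ Ty.nat

/-- The total functionals of type `σ`: all set-theoretic functionals. -/
def Tot : Ty → Type
  | .nat => ℕ
  | .arr σ τ => Tot σ → Tot τ

/-- The partial functionals of type `σ`: they accept total arguments only, and take
values in `ℕ ∪ {⊥}`. -/
def Par : Ty → Type
  | .nat => Part ℕ
  | .arr σ τ => Tot σ → Par τ

/-- The extension order on partial functionals: at type `0` the flat order (`Part.none` below
everything, distinct numbers incomparable), at higher types the pointwise order. -/
instance Par.partialOrder : (σ : Ty) → PartialOrder (Par σ)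
  | .nat => inferInstanceAs (PartialOrder (Part ℕ))
  | .arr σ τ =>
    letI := Par.partialOrder τ
    inferInstanceAs (PartialOrder (Tot σ → Par τ))

/-- The nowhere defined functional. -/
instance Par.orderBot : (σ : Ty) → OrderBot (Par σ)
  | .nat => inferInstanceAs (OrderBot (Part ℕ))
  | .arr σ τ =>
    letI := Par.orderBot τ
    inferInstanceAs (OrderBot (Tot σ → Par τ))

/-- A total functional regarded as a partial one. -/
def toPar : {σ : Ty} → Tot σ → Par σ
  | .nat, n => Part.some (show ℕ from n)
  | .arr _ _, f => fun x => toPar (f x)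

open Classical in
/-- Application of a partial functional to a partial argument: nowhere defined unless the
argument is total. -/
noncomputable def Par.app {σ τ : Ty} (u : Par (σ ⇒ τ)) (v : Par σ) : Par τ :=
  if h : ∃ x : Tot σ, toPar x = v then u h.choose else ⊥

open Classical in
/-- The least fixed point of `f`, which exists for every monotone `f`
(see `Par.exists_least_fixedPoint`). -/
noncomputable def Par.lfp {σ : Ty} (f : Par σ → Par σ) : Par σ :=
  if h : ∃ x, IsLeast {y | f y = y} x then h.choose else ⊥

/-- Definition by cases: `t` if the value of `c` is `0`, and `e` if it is a successor. Only the
selected branch has to be defined. -/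
def caseNat (c t e : Part ℕ) : Part ℕ :=
  c.bind fun z => if z = 0 then t else e

/-! ### The term language and its interpretation -/

/-- Variables (typed de Bruijn indices) in a context. -/
inductive Var : List Ty → Ty → Type
  | zero {Γ : List Ty} {σ : Ty} : Var (σ :: Γ) σ
  | succ {Γ : List Ty} {σ τ : Ty} : Var Γ σ → Var (τ :: Γ) σ

/-- Terms without secondary constants, whose free variables are listed in the context `Γ`.
The constant `case` is a term former, because its last two arguments
need not both be defined. -/
inductive Term : List Ty → Ty → Type
  | var {Γ : List Ty} {σ : Ty} : Var Γ σ → Term Γ σ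
  | zero {Γ : List Ty} : Term Γ Ty.nat
  | suc {Γ : List Ty} : Term Γ (Ty.nat ⇒ Ty.nat)
  | pred {Γ : List Ty} : Term Γ (Ty.nat ⇒ Ty.nat)
  | caseOf {Γ : List Ty} : Term Γ Ty.nat → Term Γ Ty.nat → Term Γ Ty.nat → Term Γ Ty.nat
  | app {Γ : List Ty} {σ τ : Ty} : Term Γ (σ ⇒ τ) → Term Γ σ → Term Γ τ
  | lam {Γ : List Ty} {σ τ : Ty} : (σ ⇒ τ).rank ≤ 3 → Term (σ :: Γ) τ → Term Γ (σ ⇒ τ)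
  | mu {Γ : List Ty} {σ : Ty} : σ.rank ≤ 3 → Term (σ :: Γ) σ → Term Γ σ

/-- Assignments of partial functionals to the variables of a context. -/
def Env : List Ty → Type
  | [] => Unit
  | σ :: Γ => Par σ × Env Γ

def Env.get : {Γ : List Ty} → {σ : Ty} → Var Γ σ → Env Γ → Par σ
  | _, _, .zero, ρ => ρ.1
  | _, _, .succ x, ρ => Env.get x ρ.2

/-- The interpretation of terms. -/
noncomputable def Term.eval : {Γ : List Ty} → {σ : Ty} → Term Γ σ → Env Γ → Par σ
  | _, _, .var x, ρ => Env.get x ρ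
  | _, _, .zero, _ => Part.some 0
  | _, _, .suc, _ => fun n : ℕ => Part.some (n + 1)
  | _, _, .pred, _ => fun n : ℕ => Part.some (n - 1)
  | _, _, .caseOf c t e, ρ => caseNat (c.eval ρ) (t.eval ρ) (e.eval ρ)
  | _, _, .app t s, ρ => Par.app (t.eval ρ) (s.eval ρ)
  | _, _, .lam _ t, ρ => fun x => t.eval (toPar x, ρ)
  | _, _, .mu _ t, ρ => Par.lfp fun y => t.eval (y, ρ)

/-! ### The interpretation is monotone, so that the least fixed points in it exist -/

theorem Par.exists_isLUB_of_isChain : (σ : Ty) → (c : Set (Par σ)) → IsChain (· ≤ ·) c →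
    ∃ x, IsLUB c x
  | .nat, c, hc => by
    by_cases h : ∃ n : ℕ, (show Par .nat from Part.some n) ∈ c
    · obtain ⟨n, hn⟩ := h
      refine ⟨Part.some n, fun x hx => ?_, fun y hy => hy hn⟩
      rcases hc.total hx hn with h | h
      · exact h
      · exact le_of_eq (Part.eq_some_iff.2 (h n (Part.mem_some n)))
    · refine ⟨Part.none, fun x hx => ?_, fun y _ => bot_le (α := Part ℕ)⟩
      intro m hm
      exact absurd ⟨m, (Part.eq_some_iff.2 hm) ▸ hx⟩ h
  | .arr σ τ, c, hc => by
    have key : ∀ a : Tot σ, ∃ x, IsLUB ((fun u : Par (σ ⇒ τ) => (u a : Par τ)) '' c) x := by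
      intro a
      apply Par.exists_isLUB_of_isChain τ
      rintro _ ⟨u, hu, rfl⟩ _ ⟨v, hv, rfl⟩ _
      exact (hc.total hu hv).imp (fun h => h a) (fun h => h a)
    choose g hg using key
    refine ⟨g, fun u hu a => (hg a).1 ⟨u, hu, rfl⟩, fun v hv a => (hg a).2 ?_⟩
    rintro _ ⟨u, hu, rfl⟩
    exact hv hu a

theorem Par.exists_least_prefixedPoint {σ : Ty} {f : Par σ → Par σ} (hf : Monotone f) :
    ∃ x, f x = x ∧ ∀ y, f y ≤ y → x ≤ y := by
  obtain ⟨m, -, hm⟩ := zorn_le_nonempty₀ {x : Par σ | x ≤ f x ∧ ∀ y, f y ≤ y → x ≤ y}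
    (fun c hcS hc _ _ => by
      obtain ⟨s, hs⟩ := Par.exists_isLUB_of_isChain σ c hc
      exact ⟨s, ⟨hs.2 fun x hx => (hcS hx).1.trans (hf (hs.1 hx)),
        fun y hy => hs.2 fun x hx => (hcS hx).2 y hy⟩, hs.1⟩)
    ⊥ ⟨bot_le, fun _ _ => bot_le⟩
  have hmem : f m ∈ {x : Par σ | x ≤ f x ∧ ∀ y, f y ≤ y → x ≤ y} :=
    ⟨hf hm.prop.1, fun y hy => (hf (hm.prop.2 y hy)).trans hy⟩
  exact ⟨m, (hm.eq_of_le hmem hm.prop.1).symm, hm.prop.2⟩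

theorem Par.exists_least_fixedPoint {σ : Ty} {f : Par σ → Par σ} (hf : Monotone f) :
    ∃ x, IsLeast {y | f y = y} x :=
  (Par.exists_least_prefixedPoint hf).imp fun _ h => ⟨h.1, fun _ hy => h.2 _ (le_of_eq hy)⟩

theorem Par.isLeast_lfp {σ : Ty} {f : Par σ → Par σ} (hf : Monotone f) :
    IsLeast {y | f y = y} (Par.lfp f) := by
  have h := Par.exists_least_fixedPoint hf
  rw [Par.lfp, dif_pos h]
  exact h.choose_spec

theorem Par.lfp_mono {σ : Ty} {f g : Par σ → Par σ} (hf : Monotone f) (hg : Monotone g)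
    (hfg : ∀ x, f x ≤ g x) : Par.lfp f ≤ Par.lfp g := by
  obtain ⟨x, hx, hle⟩ := Par.exists_least_prefixedPoint hf
  have h1 : Par.lfp f = x := (Par.isLeast_lfp hf).unique ⟨hx, fun y hy => hle y (le_of_eq hy)⟩
  rw [h1]
  exact hle _ ((hfg _).trans (le_of_eq (Par.isLeast_lfp hg).1))

theorem eq_of_toPar_le : {σ : Ty} → (x : Tot σ) → (v : Par σ) → toPar x ≤ v → v = toPar x
  | .nat, x, _, h => Part.eq_some_iff.2 (h x (Part.mem_some (α := ℕ) x))
  | .arr _ _, x, v, h => funext fun a => eq_of_toPar_le (x a) (v a) (h a)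

theorem Par.app_mono {σ τ : Ty} {u u' : Par (σ ⇒ τ)} {v v' : Par σ} (hu : u ≤ u')
    (hv : v ≤ v') : Par.app u v ≤ Par.app u' v' := by
  by_cases h : ∃ x : Tot σ, toPar x = v
  · have hvv : v' = v := by
      obtain ⟨x, rfl⟩ := h
      exact eq_of_toPar_le x v' hv
    subst hvv
    rw [Par.app, Par.app, dif_pos h, dif_pos h]
    exact hu _
  · rw [Par.app, dif_neg h]
    exact bot_le

theorem caseNat_mono {c c' t t' e e' : Part ℕ} (hc : c ≤ c') (ht : t ≤ t') (he : e ≤ e') :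
    caseNat c t e ≤ caseNat c' t' e' := by
  intro m hm
  obtain ⟨z, hz, hm⟩ := Part.mem_bind_iff.1 hm
  refine Part.mem_bind_iff.2 ⟨z, hc z hz, ?_⟩
  by_cases h0 : z = 0
  · rw [if_pos h0] at hm ⊢
    exact ht m hm
  · rw [if_neg h0] at hm ⊢
    exact he m hm

/-- The pointwise extension order on assignments. -/
def Env.Le : {Γ : List Ty} → Env Γ → Env Γ → Prop
  | [], _, _ => True
  | _ :: _, ρ, ρ' => ρ.1 ≤ ρ'.1 ∧ Env.Le ρ.2 ρ'.2

theorem Env.Le.rfl : {Γ : List Ty} → (ρ : Env Γ) → Env.Le ρ ρ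
  | [], _ => trivial
  | _ :: _, ρ => ⟨le_rfl, Env.Le.rfl ρ.2⟩

theorem Env.get_mono {Γ : List Ty} {σ : Ty} (x : Var Γ σ) :
    ∀ {ρ ρ' : Env Γ}, Env.Le ρ ρ' → Env.get x ρ ≤ Env.get x ρ' := by
  induction x with
  | zero => exact fun h => h.1
  | succ x ih => exact fun h => ih h.2

theorem Term.eval_mono {Γ : List Ty} {σ : Ty} (t : Term Γ σ) :
    ∀ {ρ ρ' : Env Γ}, Env.Le ρ ρ' → t.eval ρ ≤ t.eval ρ' := by
  induction t with
  | var x => exact fun h => Env.get_mono x h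
  | zero => exact fun _ => le_rfl
  | suc => exact fun _ => le_rfl
  | pred => exact fun _ => le_rfl
  | caseOf c t e ihc iht ihe =>
    exact fun h => caseNat_mono (ihc h) (iht h) (ihe h)
  | app t s iht ihs => exact fun h => Par.app_mono (iht h) (ihs h)
  | lam _ t ih => exact fun h x => ih ⟨le_rfl, h⟩
  | mu _ t ih =>
    intro ρ ρ' h
    exact Par.lfp_mono (fun _ _ hxy => ih ⟨hxy, Env.Le.rfl ρ⟩)
      (fun _ _ hxy => ih ⟨hxy, Env.Le.rfl ρ'⟩) fun x => ih ⟨le_rfl, h⟩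

/-! ### Computability modulo `∃²` -/

/-- `ψ` is computable in the functionals listed by the assignment `ρ`. -/
def ComputableIn {Γ : List Ty} (ρ : Env Γ) {τ : Ty} (ψ : Par τ) : Prop :=
  ∃ s : Term Γ τ, ψ ≤ s.eval ρ

open Classical in
/-- Kleene's quantifier `∃²`. -/
noncomputable def existsTwo : Tot Ty.two :=
  fun f : ℕ → ℕ => if ∃ n, f n = 0 then (0 : ℕ) else (1 : ℕ)

/-- `ψ` is computable in `φ` and `∃²`. -/
def ComputableModE2 {σ τ : Ty} (ψ : Par τ) (φ : Par σ) : Prop :=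
  ComputableIn (Γ := [σ, Ty.two]) (φ, toPar existsTwo, ()) ψ

/-- The cluster of a class `B` of functionals, all of which satisfy the (incomplete) description
of one functional, such as `Ω`. A functional `Φ` belongs to the cluster if, modulo `∃²`, it
computes an instance of `B` and is computable in each instance of `B`. (Any two members of the
cluster compute each other; if `B` has only one instance, the cluster is its equivalence class.) -/
def Cluster {σ : Ty} (B : Set (Par σ)) (τ : Ty) : Set (Par τ) :=
  {Φ | (∃ b ∈ B, ComputableModE2 b Φ) ∧ ∀ b ∈ B, ComputableModE2 Φ b}

/-- A class `C` of functionals is in the cluster of `B` if each element of `C` computes `B` modulo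
`∃²`, and at least one element of `C` belongs to the cluster. -/
def InCluster {σ τ : Ty} (B : Set (Par σ)) (C : Set (Par τ)) : Prop :=
  (∀ c ∈ C, ∃ b ∈ B, ComputableModE2 b c) ∧ ∃ c ∈ C, c ∈ Cluster B τ

/-! ### The domains `ℕ^ℕ`, `2^ℕ`, `[0,1]` and `ℝ`, and their coding by type `1` objects -/

/-- The rational coded by a number: all quotients `(a - b) / (c + 1)`. -/
def ratOf (m : ℕ) : ℚ :=
  ((m.unpair.1.unpair.1 : ℚ) - (m.unpair.1.unpair.2 : ℚ)) / ((m.unpair.2 : ℚ) + 1)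

/-- `x` is a fast converging Cauchy sequence of rationals with limit `r`. -/
def CodesReal (x : ℕ → ℕ) (r : ℝ) : Prop :=
  (∀ n i : ℕ, |ratOf (x n) - ratOf (x (n + i))| < 1 / 2 ^ n) ∧
    Filter.Tendsto (fun n => (ratOf (x n) : ℝ)) Filter.atTop (nhds r)

inductive Dom : Type
  | baire | cantor | unit | line

/-- The points of a domain. -/
def Dom.Pt : Dom → Type
  | .baire => ℕ → ℕ
  | .cantor => ℕ → Bool
  | .unit => unitInterval
  | .line => ℝ

/-- `D.Names x p`: the type `1` object `x` represents the point `p`. -/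
def Dom.Names : (D : Dom) → (ℕ → ℕ) → D.Pt → Prop
  | .baire, x, p => x = p
  | .cantor, x, p => ∀ n, x n = Bool.toNat (p n)
  | .unit, x, p => CodesReal x (p : unitInterval).1
  | .line, x, p => CodesReal x p

/-- The type `2` object `G` represents the function `g` from the domain to `ℕ`. -/
def Dom.RepFun (D : Dom) (G : Tot Ty.two) (g : D.Pt → ℕ) : Prop :=
  ∀ (x : ℕ → ℕ) (p : D.Pt), D.Names x p → G x = g p

/-- The type `2` object `G` represents the characteristic function of the set `X`. -/
def Dom.RepSet (D : Dom) (G : Tot Ty.two) (X : Set D.Pt) : Prop :=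
  D.RepFun G (X.indicator fun _ => 1)

/-- The `i`-th entry of the finite sequence of type `1` objects coded by `s`. -/
def entry (s : ℕ → ℕ) (i : ℕ) : ℕ → ℕ := fun k => s (Nat.pair i k + 1)

/-- `s` codes a finite sequence of type `1` objects (its length is `s 0`)
that represents the finite sequence `l` of points. -/
def Dom.NamesList (D : Dom) (s : ℕ → ℕ) (l : List D.Pt) : Prop :=
  s 0 = l.length ∧ ∀ (i : ℕ) (h : i < l.length), D.Names (entry s i) l[i]

/-- `s` codes a finite sequence of points that includes all elements of `X`. -/
def Dom.Lists (D : Dom) (X : Set D.Pt) (s : Tot Ty.one) : Prop :=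
  ∃ l : List D.Pt, D.NamesList s l ∧ ∀ p ∈ X, p ∈ l

/-- `e` is an enumeration of `A`: a sequence of one-element sequences `⟨xₙ⟩` where the `xₙ` are
exactly the elements of `A`; the enumeration of the empty set is the null sequence, all of whose
terms are the empty sequence `⟨⟩`. -/
def Dom.Enumerates (D : Dom) (A : Set D.Pt) (e : Tot (Ty.nat ⇒ Ty.one)) : Prop :=
  (∃ x : ℕ → D.Pt, Set.range x = A ∧ ∀ n : ℕ, D.NamesList (e n) [x n]) ∨
    (A = ∅ ∧ ∀ n : ℕ, D.NamesList (e n) [])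

/-! ### Functionals on sets of points -/

/-- The partial functionals `Φ(X)` of a set `X`, defined exactly when `dom X` holds, and whose
value `y` then satisfies `out X y`. -/
def Dom.SetFunctional (D : Dom) (τ : Ty) (dom : Set D.Pt → Prop)
    (out : Set D.Pt → Tot τ → Prop) : Set (Par (Ty.two ⇒ τ)) :=
  {Φ | ∀ G : Tot Ty.two,
    (∀ X, D.RepSet G X → dom X → ∃ y : Tot τ, Φ G = toPar y ∧ out X y) ∧
    ((∀ X, D.RepSet G X → ¬ dom X) → Φ G = ⊥)}

/-- The same for functionals `Φ(A, Y)` of a set `A` and a function `Y` into `ℕ`. -/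
def Dom.SetFunFunctional (D : Dom) (τ : Ty) (dom : Set D.Pt → (D.Pt → ℕ) → Prop)
    (out : Set D.Pt → Tot τ → Prop) : Set (Par (Ty.two ⇒ Ty.two ⇒ τ)) :=
  {Φ | ∀ G H : Tot Ty.two,
    (∀ A Y, D.RepSet G A → D.RepFun H Y → dom A Y → ∃ y : Tot τ, Φ G H = toPar y ∧ out A y) ∧
    ((∀ A Y, D.RepSet G A → D.RepFun H Y → ¬ dom A Y) → Φ G H = ⊥)}

/-- `Ω₁`: defined on singletons `{p}`, with value `p`. -/
def OmegaOne (D : Dom) : Set (Par (Ty.two ⇒ Ty.one)) :=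
  D.SetFunctional Ty.one (fun X => ∃ p, X = {p}) (fun X y => ∃ p, X = {p} ∧ D.Names y p)

/-- `Ω`: defined if `|X| ≤ 1`, outputs a finite sequence that includes all elements of `X`. -/
def Omega (D : Dom) : Set (Par (Ty.two ⇒ Ty.one)) :=
  D.SetFunctional Ty.one (fun X => X.encard ≤ 1) D.Lists

/-- `Ω_n` on `[0,1]`. -/
def OmegaEq (n : ℕ) : Set (Par (Ty.two ⇒ Ty.one)) :=
  Dom.unit.SetFunctional Ty.one (fun X => X.encard = n) Dom.unit.Lists

/-- `Ω_{≤n}` on `[0,1]`. -/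
def OmegaLe (n : ℕ) : Set (Par (Ty.two ⇒ Ty.one)) :=
  Dom.unit.SetFunctional Ty.one (fun X => X.encard ≤ n) Dom.unit.Lists

/-- `Ω_fin` on `[0,1]`. -/
def OmegaFin : Set (Par (Ty.two ⇒ Ty.one)) :=
  Dom.unit.SetFunctional Ty.one (fun X => X.Finite) Dom.unit.Lists

/-- `Ω_{#,fin}` on `[0,1]`: outputs the cardinality of a finite set. -/
def OmegaCard : Set (Par (Ty.two ⇒ Ty.nat)) :=
  Dom.unit.SetFunctional Ty.nat (fun X => X.Finite) (fun X (n : ℕ) => X.encard = n)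

/-- `Ω_{≥#,fin}` on `[0,1]`: outputs an upper bound on the cardinality of a finite set. -/
def OmegaCardBound : Set (Par (Ty.two ⇒ Ty.nat)) :=
  Dom.unit.SetFunctional Ty.nat (fun X => X.Finite) (fun X (n : ℕ) => X.encard ≤ n)

/-- Enumeration functionals: the input is `A ⊆ [0,1]` and `Y` injective on `A`. -/
def EnumerationFunctional : Set (Par (Ty.two ⇒ Ty.two ⇒ Ty.nat ⇒ Ty.one)) :=
  Dom.unit.SetFunFunctional (Ty.nat ⇒ Ty.one) (fun A Y => Set.InjOn Y A) Dom.unit.Enumerates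

/-- Weak enumeration functionals: moreover, `Y` maps `A` onto `ℕ`. -/
def WeakEnumerationFunctional : Set (Par (Ty.two ⇒ Ty.two ⇒ Ty.nat ⇒ Ty.one)) :=
  Dom.unit.SetFunFunctional (Ty.nat ⇒ Ty.one)
    (fun A Y => Set.InjOn Y A ∧ Set.SurjOn Y A Set.univ) Dom.unit.Enumerates

/-- `y` represents the supremum of `A` in the ordered set `[0,1]` (in particular `sup ∅ = 0`). -/
def NamesSup (A : Set Dom.unit.Pt) (y : Tot Ty.one) : Prop :=
  ∃ p : unitInterval, IsLUB (show Set unitInterval from A) p ∧ Dom.unit.Names y p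

/-- `Ω_BW`: the input is `A ⊆ [0,1]` and `Y` injective on `A`, the output is `sup A`. -/
def OmegaBW : Set (Par (Ty.two ⇒ Ty.two ⇒ Ty.one)) :=
  Dom.unit.SetFunFunctional Ty.one (fun A Y => Set.InjOn Y A) NamesSup

/-- The weak `Ω_BW`: moreover, `Y` maps `A` onto `ℕ`. -/
def WeakOmegaBW : Set (Par (Ty.two ⇒ Ty.two ⇒ Ty.one)) :=
  Dom.unit.SetFunFunctional Ty.one
    (fun A Y => Set.InjOn Y A ∧ Set.SurjOn Y A Set.univ) NamesSup

end HigherType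

namespace HigherType

/-!
Every functional of the theorem is compared, modulo `∃²`, with functionals on characteristic
functions of subsets of the Baire space: from any name of a point of one of the domains a
canonical name of it is computable, and the Baire space embeds computably into each domain. The
functionals of the first cluster compute whether the element of a singleton starts with `0`, and
are computable from the functional that finds this element; those of the second cluster compute
whether a set with at most one element is nonempty, and are computable from the functional that
sorts finite sets.

Both intervals collapse. The element of a singleton, and the sorted code of a set with at most one
element, are found from the graph of the element, whose bits are obtained by queries in parallel.
Finite sets are sorted by recursion on their cardinality: the sorted code of `X` is the only
element of a set in which membership of `s` depends only on the size of `X` without the first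
entry of `s`, and this size is known from a recursive call.
-/

/-! ### Term functions of a family of assignments -/

section TermFunction

variable {I J : Type} {Γ Δ : List Ty} {σ τ : Ty} {E : I → Env Γ} {E' : I → Env Δ}

theorem Term.exists_eval_eq_of_var (t : Term Γ τ)
    (h : ∀ {σ} (x : Var Γ σ), ∃ y : Var Δ σ, ∀ i, Env.get y (E' i) = Env.get x (E i)) :
    ∃ t' : Term Δ τ, ∀ i, t'.eval (E' i) = t.eval (E i) := by
  have lift {I : Type} {Γ Δ : List Ty} {E : I → Env Γ} {E' : I → Env Δ} (α : Ty)
      (h : ∀ {σ} (x : Var Γ σ), ∃ y : Var Δ σ, ∀ i, Env.get y (E' i) = Env.get x (E i))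
      {σ : Ty} (x : Var (α :: Γ) σ) : ∃ y : Var (α :: Δ) σ, ∀ p : Par α × I,
        Env.get (Γ := α :: Δ) y (p.1, E' p.2) = Env.get (Γ := α :: Γ) x (p.1, E p.2) := by
    cases x with
    | zero => exact ⟨.zero, fun _ => rfl⟩
    | succ x => exact (h x).elim fun y hy => ⟨.succ y, fun p => hy p.2⟩
  induction t generalizing I Δ with
  | var x => exact (h x).elim fun y hy => ⟨.var y, hy⟩
  | zero => exact ⟨.zero, fun _ => rfl⟩
  | suc => exact ⟨.suc, fun _ => rfl⟩
  | pred => exact ⟨.pred, fun _ => rfl⟩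
  | caseOf _ _ _ ihc iht ihe =>
    obtain ⟨⟨c, hc⟩, ⟨t, ht⟩, e, he⟩ := And.intro (ihc h) (And.intro (iht h) (ihe h))
    exact ⟨.caseOf c t e, fun i => congr (congr (congrArg caseNat (hc i)) (ht i)) (he i)⟩
  | app _ _ iht ihs =>
    obtain ⟨⟨t, ht⟩, s, hs⟩ := And.intro (iht h) (ihs h)
    exact ⟨.app t s, fun i => congr (congrArg Par.app (ht i)) (hs i)⟩
  | lam hr _ ih =>
    obtain ⟨t, ht⟩ := ih (lift _ h)
    exact ⟨.lam hr t, fun i => funext fun x => ht (toPar x, i)⟩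
  | mu hr _ ih =>
    obtain ⟨t, ht⟩ := ih (lift _ h)
    exact ⟨.mu hr t, fun i => congrArg Par.lfp (funext fun y => ht (y, i))⟩

/-- The function `f` on the index set of the family `E` of assignments is the value of one term,
uniformly in the index. Binding a variable of type `σ` turns the index set `I` into `Par σ × I` or
`Tot σ × I`, which replaces all calculations with de Bruijn indices. -/
def TermFunction (E : I → Env Γ) (f : I → Par τ) : Prop :=
  ∃ t : Term Γ τ, ∀ i, t.eval (E i) = f i

theorem TermFunction.weaken {f : I → Par τ} (hf : TermFunction E f) (a : J → Par σ) (r : J → I) :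
    TermFunction (Γ := σ :: Γ) (fun j => (a j, E (r j))) fun j => f (r j) := by
  obtain ⟨t, ht⟩ := hf
  obtain ⟨t', ht'⟩ := t.exists_eval_eq_of_var (E := fun j => E (r j)) (Δ := σ :: Γ)
    (E' := fun j => (a j, E (r j))) fun x => ⟨.succ x, fun _ => rfl⟩
  exact ⟨t', fun j => (ht' j).trans (ht (r j))⟩

theorem TermFunction.subst {f : I → Par τ} (hf : TermFunction E f)
    (h : ∀ {σ} (x : Var Γ σ), TermFunction E' fun i => Env.get x (E i)) : TermFunction E' f := by
  have lift {I : Type} {Γ Δ : List Ty} {E : I → Env Γ} {E' : I → Env Δ} (α : Ty)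
      (h : ∀ {σ} (x : Var Γ σ), TermFunction E' fun i => Env.get x (E i))
      {σ : Ty} (x : Var (α :: Γ) σ) :
      TermFunction (Γ := α :: Δ) (fun p : Par α × I => (p.1, E' p.2))
        fun p => Env.get (Γ := α :: Γ) x (p.1, E p.2) := by
    cases x with
    | zero => exact ⟨.var .zero, fun _ => rfl⟩
    | succ x => exact (h x).weaken _ _
  obtain ⟨t, ht⟩ := hf
  obtain rfl : (fun i => t.eval (E i)) = f := funext ht
  clear ht
  induction t generalizing I Δ with
  | var x => exact h x
  | zero => exact ⟨.zero, fun _ => rfl⟩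
  | suc => exact ⟨.suc, fun _ => rfl⟩
  | pred => exact ⟨.pred, fun _ => rfl⟩
  | caseOf _ _ _ ihc iht ihe =>
    obtain ⟨⟨c, hc⟩, ⟨t, ht⟩, e, he⟩ := And.intro (ihc h) (And.intro (iht h) (ihe h))
    exact ⟨.caseOf c t e, fun i => congr (congr (congrArg caseNat (hc i)) (ht i)) (he i)⟩
  | app _ _ iht ihs =>
    obtain ⟨⟨t, ht⟩, s, hs⟩ := And.intro (iht h) (ihs h)
    exact ⟨.app t s, fun i => congr (congrArg Par.app (ht i)) (hs i)⟩
  | lam hr _ ih =>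
    obtain ⟨t, ht⟩ := ih (lift _ h)
    exact ⟨.lam hr t, fun i => funext fun x => ht (toPar x, i)⟩
  | mu hr _ ih =>
    obtain ⟨t, ht⟩ := ih (lift _ h)
    exact ⟨.mu hr t, fun i => congrArg Par.lfp (funext fun y => ht (y, i))⟩

end TermFunction

theorem ComputableModE2.trans {σ τ υ : Ty} {χ : Par υ} {ψ : Par τ} {φ : Par σ}
    (h₁ : ComputableModE2 χ ψ) (h₂ : ComputableModE2 ψ φ) : ComputableModE2 χ φ := by
  obtain ⟨s, hs⟩ := h₁
  obtain ⟨t, ht⟩ := h₂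
  let ρ : Env [σ, Ty.two] := (φ, toPar existsTwo, ())
  let ρ' : Env [τ, Ty.two] := (t.eval ρ, toPar existsTwo, ())
  obtain ⟨r, hr⟩ : TermFunction (fun _ : Unit => ρ) fun _ => s.eval ρ' :=
    TermFunction.subst (E := fun _ => ρ') ⟨s, fun _ => rfl⟩ fun x => by
      cases x with
      | zero => exact ⟨t, fun _ => rfl⟩
      | succ x => exact ⟨.var (.succ x), fun _ => rfl⟩
  have hle : Env.Le (Γ := [τ, Ty.two]) (ψ, toPar existsTwo, ()) ρ' := ⟨ht, le_rfl, trivial⟩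
  exact ⟨r, hs.trans ((s.eval_mono hle).trans_eq (hr ()).symm)⟩

/-! ### Application -/

theorem toPar_injective : {σ : Ty} → Function.Injective (toPar : Tot σ → Par σ)
  | .nat => fun _ _ h => Part.some_injective h
  | .arr _ _ => fun _ _ h => funext fun a => toPar_injective (congrFun h a)

@[simp]
theorem Par.app_toPar {σ τ : Ty} (u : Par (σ ⇒ τ)) (x : Tot σ) : Par.app u (toPar x) = u x := by
  have h : ∃ y : Tot σ, toPar y = toPar x := ⟨x, rfl⟩
  rw [Par.app, dif_pos h, toPar_injective h.choose_spec]

theorem Par.le_of_ne_bot {σ τ : Ty} {u v : Par (σ ⇒ τ)} (h : ∀ x, u x ≠ ⊥ → u x ≤ v x) :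
    u ≤ v := fun x => by
  by_cases hx : u x = ⊥
  · rw [hx]
    exact bot_le
  · exact h x hx

theorem caseNat_toPar (n : ℕ) (t e : Part ℕ) :
    caseNat (toPar (σ := Ty.nat) n) t e = if n = 0 then t else e :=
  Part.bind_some _ _

/-! ### Functions definable in `∃²` -/

/-- The assignment `ρ`, followed by `∃²`. -/
noncomputable def Env.withE2 : {Γ : List Ty} → Env Γ → Env (Γ ++ [Ty.two])
  | [], _ => (toPar existsTwo, ())
  | _ :: _, ρ => (ρ.1, Env.withE2 ρ.2)

section Definable

variable {I J : Type} {Γ : List Ty} {σ τ : Ty}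

/-- The family `E` of assignments, extended by a variable for a partial functional. -/
def bindPar (σ : Ty) (E : I → Env Γ) (p : Par σ × I) : Env (σ :: Γ) := (p.1, E p.2)

/-- The family `E` of assignments, extended by a variable for a total functional. -/
def bindTot (σ : Ty) (E : I → Env Γ) (p : Tot σ × I) : Env (σ :: Γ) := (toPar p.1, E p.2)

/-- The partial functional `f i` is the value of one term in the assignment `E i` and `∃²`,
uniformly in `i`. -/
def Definable (E : I → Env Γ) (f : I → Par τ) : Prop :=
  TermFunction (fun i => (E i).withE2) f

/-- Definability of total functionals. -/
def Rec (E : I → Env Γ) (f : I → Tot τ) : Prop := Definable E fun i => toPar (f i)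

/-- The total functional `F` is computable in `∃²`. -/
def IsRec (F : Tot τ) : Prop := Rec (I := Unit) (Γ := []) id fun _ => F

variable {E : I → Env Γ}

theorem definable_existsTwo : Definable E fun _ => toPar existsTwo := by
  induction Γ with
  | nil => exact ⟨.var .zero, fun _ => rfl⟩
  | cons σ Γ ih => exact (ih (E := fun i => (E i).2)).weaken (fun i => (E i).1) id

theorem IsRec.rec {F : Tot τ} (hF : IsRec F) : Rec E fun _ => F := by
  obtain ⟨t, ht⟩ := hF
  have hF' : TermFunction (fun _ : I => Env.withE2 (Γ := []) ()) fun _ => toPar F :=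
    ⟨t, fun _ => ht ()⟩
  exact hF'.subst fun x => by
    cases x with
    | zero => exact definable_existsTwo
    | succ x => nomatch x

theorem Definable.var : Definable (bindPar σ E) fun p => p.1 := ⟨.var .zero, fun _ => rfl⟩

theorem Definable.weakenPar {f : I → Par τ} (hf : Definable E f) :
    Definable (bindPar σ E) fun p => f p.2 :=
  TermFunction.weaken hf _ _

theorem Definable.weaken {f : I → Par τ} (hf : Definable E f) :
    Definable (bindTot σ E) fun p => f p.2 :=
  TermFunction.weaken hf _ _

theorem Definable.papp {f : I → Par (σ ⇒ τ)} {g : I → Par σ} (hf : Definable E f)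
    (hg : Definable E g) : Definable E fun i => Par.app (f i) (g i) := by
  obtain ⟨⟨t, ht⟩, s, hs⟩ := And.intro hf hg
  exact ⟨.app t s, fun i => congr (congrArg Par.app (ht i)) (hs i)⟩

theorem Definable.app {f : I → Par (σ ⇒ τ)} {g : I → Tot σ} (hf : Definable E f)
    (hg : Rec E g) : Definable E fun i => f i (g i) := by
  simpa only [Par.app_toPar] using hf.papp hg

theorem Definable.lam {f : I → Tot σ → Par τ}
    (hf : Definable (bindTot σ E) fun p => f p.2 p.1)
    (h : (σ ⇒ τ).rank ≤ 3 := by decide) : Definable (τ := σ ⇒ τ) E f := by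
  obtain ⟨t, ht⟩ := hf
  exact ⟨.lam h t, fun i => funext fun x => ht (x, i)⟩

theorem Definable.caseNat {c : I → ℕ} {a b : I → Part ℕ} (hc : Rec (τ := Ty.nat) E c)
    (ha : Definable (τ := Ty.nat) E a) (hb : Definable (τ := Ty.nat) E b) :
    Definable (τ := Ty.nat) E fun i => if c i = 0 then a i else b i := by
  obtain ⟨⟨r, hr⟩, ⟨s, hs⟩, t, ht⟩ := And.intro hc (And.intro ha hb)
  exact ⟨.caseOf r s t, fun i => (congr (congr (congrArg HigherType.caseNat (hr i)) (hs i))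
    (ht i)).trans (caseNat_toPar _ _ _)⟩

theorem Definable.exists_fixedPoint {F : Par σ → I → Par σ}
    (hF : Definable (bindPar σ E) fun p => F p.1 p.2) (h : σ.rank ≤ 3 := by decide) :
    ∃ M : I → Par σ, Definable E M ∧ ∀ i, M i = F (M i) i := by
  obtain ⟨t, ht⟩ := hF
  refine ⟨fun i => (Term.mu h t).eval (E i).withE2, ⟨.mu h t, fun _ => rfl⟩, fun i => ?_⟩
  refine Eq.trans (Eq.symm ?_) (ht (_, i))
  have hmono : Monotone fun y => t.eval (y, (E i).withE2) :=
    fun _ _ hxy => t.eval_mono (And.intro hxy (Env.Le.rfl _) : Env.Le (Γ := σ :: _) (_, _) (_, _))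
  exact (Par.isLeast_lfp hmono).1

theorem Rec.var : Rec (bindTot σ E) fun p => p.1 := ⟨.var .zero, fun _ => rfl⟩

theorem Rec.weaken {f : I → Tot τ} (hf : Rec E f) : Rec (bindTot σ E) fun p => f p.2 :=
  Definable.weaken hf

theorem Rec.weakenPar {f : I → Tot τ} (hf : Rec E f) : Rec (bindPar σ E) fun p => f p.2 :=
  Definable.weakenPar hf

theorem Rec.app {f : I → Tot (σ ⇒ τ)} {g : I → Tot σ} (hf : Rec E f) (hg : Rec E g) :
    Rec E fun i => f i (g i) :=
  Definable.app (f := fun i => toPar (f i)) hf hg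

theorem Rec.lam {f : I → Tot σ → Tot τ} (hf : Rec (bindTot σ E) fun p => f p.2 p.1)
    (h : (σ ⇒ τ).rank ≤ 3 := by decide) : Rec (τ := σ ⇒ τ) E f :=
  Definable.lam hf h

end Definable

/-! ### Total functions and predicates computable in `∃²` -/

/-- `Rec` for values of type `0`. -/
abbrev RecNat {I : Type} {Γ : List Ty} (E : I → Env Γ) (f : I → ℕ) : Prop := Rec (τ := Ty.nat) E f

/-- `Rec` for values of type `1`. -/
abbrev RecSeq {I : Type} {Γ : List Ty} (E : I → Env Γ) (f : I → ℕ → ℕ) : Prop :=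
  Rec (τ := Ty.one) E f

open Classical in
/-- The truth value of a proposition, with `1` for truth. -/
noncomputable def ind (p : Prop) : ℕ := if p then 1 else 0

theorem ind_true {p : Prop} (h : p) : ind p = 1 := if_pos h

theorem ind_false {p : Prop} (h : ¬ p) : ind p = 0 := if_neg h

@[simp]
theorem ind_eq_one {p : Prop} : ind p = 1 ↔ p := by
  by_cases h : p <;> simp [ind, h]

@[simp]
theorem ind_eq_zero {p : Prop} : ind p = 0 ↔ ¬ p := by
  by_cases h : p <;> simp [ind, h]

theorem ind_congr {p q : Prop} (h : p ↔ q) : ind p = ind q := congrArg ind (propext h)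

theorem ite_ind_eq_zero (p q : Prop) : (if ind p = 0 then 0 else ind q) = ind (p ∧ q) := by
  by_cases h : p
  · rw [if_neg (by simpa using h), ind_congr (and_iff_right h)]
  · rw [if_pos (ind_false h), ind_false fun hpq => h hpq.1]

theorem ind_le_one (p : Prop) : ind p ≤ 1 := by
  unfold ind
  split_ifs
  exacts [le_rfl, zero_le_one]

/-- `Rec` for predicates, by way of their truth values. -/
abbrev RecPred {I : Type} {Γ : List Ty} (E : I → Env Γ) (p : I → Prop) : Prop :=
  RecNat E fun i => ind (p i)

section Closure

variable {I : Type} {Γ : List Ty} {E : I → Env Γ} {f g : I → ℕ} {p q : I → Prop}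

theorem RecNat.of_eq (hf : RecNat E f) (h : ∀ i, f i = g i) : RecNat E g := by
  rwa [← funext h]

theorem RecPred.of_iff (hp : RecPred E p) (h : ∀ i, p i ↔ q i) : RecPred E q := by
  rwa [← funext fun i => propext (h i)]

theorem RecSeq.app {F : I → ℕ → ℕ} (hF : RecSeq E F) (hf : RecNat E f) :
    RecNat E fun i => F i (f i) :=
  Rec.app (σ := Ty.nat) (τ := Ty.nat) hF hf

theorem RecSeq.lam {F : I → ℕ → ℕ} (hF : RecNat (bindTot Ty.nat E) fun j => F j.2 j.1) :
    RecSeq E F :=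
  Rec.lam (σ := Ty.nat) (τ := Ty.nat) hF

theorem RecNat.zero : RecNat E fun _ => 0 := ⟨.zero, fun _ => rfl⟩

theorem RecNat.succ (hf : RecNat E f) : RecNat E fun i => f i + 1 :=
  RecSeq.app (F := fun _ n => n + 1) ⟨.suc, fun _ => rfl⟩ hf

theorem RecNat.pred (hf : RecNat E f) : RecNat E fun i => f i - 1 :=
  RecSeq.app (F := fun _ n => n - 1) ⟨.pred, fun _ => rfl⟩ hf

theorem RecNat.const : ∀ n : ℕ, RecNat E fun _ => n
  | 0 => .zero
  | n + 1 => (RecNat.const n).succ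

theorem RecNat.cond {c : I → ℕ} (hc : RecNat E c) (hf : RecNat E f) (hg : RecNat E g) :
    RecNat E fun i => if c i = 0 then f i else g i := by
  have h := Definable.caseNat hc hf hg
  rwa [funext fun i => (apply_ite (toPar (σ := Ty.nat)) (c i = 0) (f i) (g i)).symm] at h

theorem RecNat.natRec {n : I → ℕ} {h : I → ℕ → ℕ → ℕ} (hf : RecNat E f)
    (hh : RecNat (bindTot Ty.nat (bindTot Ty.nat E)) fun j => h j.2.2 j.2.1 j.1)
    (hn : RecNat E n) : RecNat E fun i => Nat.rec (f i) (h i) (n i) := by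
  have hh' : Rec (τ := Ty.nat ⇒ Ty.one) E h := Rec.lam (τ := Ty.one)
    (RecSeq.lam (E := bindTot Ty.nat E) (F := fun j => h j.2 j.1) hh)
  let F (u : Par Ty.one) (i : I) : Par Ty.one := fun m : ℕ => if m = 0
    then toPar (σ := Ty.nat) (f i)
    else Par.app (toPar (σ := Ty.one) (h i (m - 1))) (u (m - 1 : ℕ))
  have hF : Definable (bindPar Ty.one E) fun j => F j.1 j.2 := by
    have hm : RecNat (bindTot Ty.nat (bindPar Ty.one E)) fun j => (show ℕ from j.1) - 1 :=
      RecNat.pred Rec.var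
    exact Definable.lam (τ := Ty.nat) (Definable.caseNat Rec.var hf.weakenPar.weaken
      (Definable.papp (Rec.app hh'.weakenPar.weaken hm) (Definable.app Definable.var.weaken hm)))
  obtain ⟨M, hM, hfix⟩ := Definable.exists_fixedPoint hF
  have hMrec (i : I) (m : ℕ) :
      M i m = toPar (σ := Ty.nat) (Nat.rec (motive := fun _ => ℕ) (f i) (h i) m) := by
    induction m with
    | zero => exact congrFun (hfix i) (0 : ℕ)
    | succ m ih =>
      refine (congrFun (hfix i) (m + 1 : ℕ)).trans ((congrArg (Par.app _) ih).trans ?_)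
      exact Par.app_toPar _ _
  have happ := Definable.app hM hn
  rwa [funext fun i => hMrec i (n i)] at happ

theorem RecNat.add (hf : RecNat E f) (hg : RecNat E g) : RecNat E fun i => f i + g i := by
  refine (RecNat.natRec (h := fun _ _ m => m + 1) hf (RecNat.succ Rec.var) hg).of_eq fun i => ?_
  induction g i with
  | zero => rfl
  | succ n ih => exact congrArg Nat.succ ih

theorem RecNat.mul (hf : RecNat E f) (hg : RecNat E g) : RecNat E fun i => f i * g i := by
  refine (RecNat.natRec (h := fun i _ m => m + f i) .zero
    (RecNat.add Rec.var hf.weaken.weaken) hg).of_eq fun i => ?_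
  induction g i with
  | zero => rfl
  | succ n ih => exact congrArg (· + f i) ih

theorem RecNat.pow (hf : RecNat E f) (hg : RecNat E g) : RecNat E fun i => f i ^ g i := by
  refine (RecNat.natRec (h := fun i _ m => m * f i) (.const 1)
    (RecNat.mul Rec.var hf.weaken.weaken) hg).of_eq fun i => ?_
  induction g i with
  | zero => rfl
  | succ n ih => exact congrArg (· * f i) ih

theorem RecNat.sub (hf : RecNat E f) (hg : RecNat E g) : RecNat E fun i => f i - g i := by
  refine (RecNat.natRec (h := fun _ _ m => m - 1) hf (RecNat.pred Rec.var) hg).of_eq fun i => ?_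
  induction g i with
  | zero => rfl
  | succ n ih => exact congrArg Nat.pred ih

theorem RecPred.eq_zero (hf : RecNat E f) : RecPred E fun i => f i = 0 :=
  (hf.cond (.const 1) .zero).of_eq fun i => by by_cases h : f i = 0 <;> simp [ind, h]

theorem RecPred.not (hp : RecPred E p) : RecPred E fun i => ¬ p i :=
  (RecPred.eq_zero hp).of_iff fun _ => ind_eq_zero

theorem RecPred.and (hp : RecPred E p) (hq : RecPred E q) : RecPred E fun i => p i ∧ q i :=
  (RecNat.mul hp hq).of_eq fun i => by
    by_cases hi : p i <;> by_cases hi' : q i <;> simp [ind, hi, hi']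

theorem RecPred.or (hp : RecPred E p) (hq : RecPred E q) : RecPred E fun i => p i ∨ q i :=
  (hp.not.and hq.not).not.of_iff fun _ => by tauto

theorem RecPred.imp (hp : RecPred E p) (hq : RecPred E q) : RecPred E fun i => p i → q i :=
  (hp.not.or hq).of_iff fun _ => by tauto

theorem RecPred.le (hf : RecNat E f) (hg : RecNat E g) : RecPred E fun i => f i ≤ g i :=
  (RecPred.eq_zero (hf.sub hg)).of_iff fun _ => Nat.sub_eq_zero_iff_le

theorem RecPred.lt (hf : RecNat E f) (hg : RecNat E g) : RecPred E fun i => f i < g i :=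
  RecPred.le hf.succ hg

theorem RecPred.eq (hf : RecNat E f) (hg : RecNat E g) : RecPred E fun i => f i = g i :=
  ((RecPred.le hf hg).and (RecPred.le hg hf)).of_iff fun _ => le_antisymm_iff.symm

open Classical in
theorem RecNat.ite (hp : RecPred E p) (hf : RecNat E f) (hg : RecNat E g) :
    RecNat E fun i => if p i then f i else g i :=
  (RecNat.cond hp hg hf).of_eq fun i => by simp only [ind_eq_zero, ite_not]

theorem RecPred.ex {p : I → ℕ → Prop} (hp : RecPred (bindTot Ty.nat E) fun j => p j.2 j.1) :
    RecPred E fun i => ∃ n, p i n := by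
  have hseq : RecSeq E fun i n => ind (¬ p i n) := RecSeq.lam (RecPred.not hp)
  refine (RecPred.eq_zero (f := fun i => existsTwo fun n : ℕ => ind (¬ p i n))
    (Rec.app (σ := Ty.one) (τ := Ty.nat) definable_existsTwo hseq)).of_iff fun i => ?_
  by_cases h : ∃ n, p i n <;> simp [existsTwo, h]

theorem RecPred.all {p : I → ℕ → Prop} (hp : RecPred (bindTot Ty.nat E) fun j => p j.2 j.1) :
    RecPred E fun i => ∀ n, p i n :=
  (RecPred.ex (p := fun i n => ¬ p i n) (RecPred.not hp)).not.of_iff fun _ => not_exists_not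

/-- The search program `M n = if p n then n else M (n + 1)`. -/
theorem Definable.exists_search {p : I → ℕ → Prop}
    (hp : RecPred (bindTot Ty.nat E) fun j => p j.2 j.1) :
    ∃ M : I → Par Ty.one, Definable E M ∧ ∀ i (n : ℕ),
      (p i n → M i n = toPar (σ := Ty.nat) n) ∧ (¬ p i n → M i n = M i (n + 1 : ℕ)) := by
  have hp' : RecSeq E fun i n => ind (p i n) := RecSeq.lam hp
  let F (u : Par Ty.one) (i : I) : Par Ty.one := fun n : ℕ =>
    if ind (p i n) = 0 then u (n + 1 : ℕ) else toPar (σ := Ty.nat) n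
  have hF : Definable (bindPar Ty.one E) fun j => F j.1 j.2 :=
    Definable.lam (τ := Ty.nat) (Definable.caseNat
      (RecSeq.app (F := fun (j : Tot Ty.nat × Par Ty.one × I) n => ind (p j.2.2 n))
        hp'.weakenPar.weaken Rec.var)
      (Definable.app Definable.var.weaken (RecNat.succ Rec.var)) Rec.var)
  obtain ⟨M, hM, hfix⟩ := Definable.exists_fixedPoint hF
  refine ⟨M, hM, fun i n => ⟨fun h => ?_, fun h => ?_⟩⟩
  · exact (congrFun (hfix i) n).trans (if_neg fun h0 => ind_eq_zero.1 h0 h)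
  · exact (congrFun (hfix i) n).trans (if_pos (ind_eq_zero.2 h))

theorem RecNat.nat_sInf {p : I → ℕ → Prop} (hp : RecPred (bindTot Ty.nat E) fun j => p j.2 j.1) :
    RecNat E fun i => sInf {n | p i n} := by
  obtain ⟨M, hM, hMn⟩ := Definable.exists_search hp
  have hsearch (i : I) (k n : ℕ) (h : p i (n + k)) (hlt : ∀ j < k, ¬ p i (n + j)) :
      M i n = toPar (σ := Ty.nat) (n + k : ℕ) := by
    induction k generalizing n with
    | zero => exact (hMn i n).1 h
    | succ k ih =>
      have hnk : n + (k + 1) = n + 1 + k := by ring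
      rw [(hMn i n).2 (hlt 0 k.succ_pos), hnk]
      refine ih (n + 1) (hnk ▸ h) fun j hj => ?_
      rw [Nat.add_right_comm]
      exact hlt (j + 1) (Nat.succ_lt_succ hj)
  have hdef := Definable.caseNat (RecPred.ex hp) (RecNat.const 0)
    (Definable.app hM (RecNat.const 0))
  have heq (i : I) : (if ind (∃ n, p i n) = 0 then toPar (σ := Ty.nat) (0 : ℕ) else M i (0 : ℕ)) =
      toPar (σ := Ty.nat) (sInf {n | p i n} : ℕ) := by
    by_cases h : ∃ n, p i n
    · have hmem := Nat.sInf_mem (s := {n | p i n}) h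
      rw [if_neg fun h0 => ind_eq_zero.1 h0 h]
      refine (hsearch i (sInf {n | p i n}) 0 (by rwa [Nat.zero_add]) fun j hj => ?_).trans
        (by rw [Nat.zero_add])
      rw [Nat.zero_add]
      exact Nat.notMem_of_lt_sInf hj
    · have hempty : {n | p i n} = ∅ := Set.eq_empty_of_forall_notMem fun n hn => h ⟨n, hn⟩
      rw [if_pos (ind_eq_zero.2 h), hempty, Nat.sInf_empty]
  rwa [funext heq] at hdef

open Classical in
theorem RecNat.pair (hf : RecNat E f) (hg : RecNat E g) :
    RecNat E fun i => Nat.pair (f i) (g i) :=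
  (RecNat.ite (RecPred.lt hf hg) ((hg.mul hg).add hf) (((hf.mul hf).add hf).add hg)).of_eq
    fun i => by unfold Nat.pair; congr

theorem RecNat.left (hf : RecNat E f) : RecNat E fun i => (f i).unpair.1 := by
  refine (RecNat.nat_sInf (p := fun i a => ∃ b, Nat.pair a b = f i) (RecPred.ex
    (p := fun (j : Tot Ty.nat × I) b => Nat.pair j.1 b = f j.2)
    (RecPred.eq (RecNat.pair Rec.var.weaken Rec.var) hf.weaken.weaken))).of_eq fun i => ?_
  have h : {a | ∃ b, Nat.pair a b = f i} = {(f i).unpair.1} := Set.ext fun a =>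
    ⟨fun ⟨b, hb⟩ => by simp [← hb], fun ha => ⟨(f i).unpair.2, ha ▸ Nat.pair_unpair _⟩⟩
  rw [h, csInf_singleton]

theorem RecNat.right (hf : RecNat E f) : RecNat E fun i => (f i).unpair.2 := by
  refine (RecNat.nat_sInf (p := fun i b => ∃ a, Nat.pair a b = f i) (RecPred.ex
    (p := fun (j : Tot Ty.nat × I) a => Nat.pair a j.1 = f j.2)
    (RecPred.eq (RecNat.pair Rec.var Rec.var.weaken) hf.weaken.weaken))).of_eq fun i => ?_
  have h : {b | ∃ a, Nat.pair a b = f i} = {(f i).unpair.2} := Set.ext fun b =>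
    ⟨fun ⟨a, ha⟩ => by simp [← ha], fun hb => ⟨(f i).unpair.1, hb ▸ Nat.pair_unpair _⟩⟩
  rw [h, csInf_singleton]

theorem RecPred.funEq {F G : I → ℕ → ℕ} (hF : RecSeq E F) (hG : RecSeq E G) :
    RecPred E fun i => F i = G i :=
  (RecPred.all (p := fun i n => F i n = G i n)
    (RecPred.eq (RecSeq.app hF.weaken Rec.var) (RecSeq.app hG.weaken Rec.var))).of_iff
    fun _ => funext_iff.symm

theorem RecPred.toLex_lt {x y : I → ℕ → ℕ} (hx : RecSeq E x) (hy : RecSeq E y) :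
    RecPred E fun i => toLex (x i) < toLex (y i) :=
  (RecPred.ex (p := fun i n => (∀ j, j < n → x i j = y i j) ∧ x i n < y i n)
    (RecPred.and (RecPred.all (RecPred.imp (RecPred.lt Rec.var Rec.var.weaken)
      (RecPred.eq (RecSeq.app hx.weaken.weaken Rec.var) (RecSeq.app hy.weaken.weaken Rec.var))))
      (RecPred.lt (RecSeq.app hx.weaken Rec.var) (RecSeq.app hy.weaken Rec.var)))).of_iff
    fun _ => Iff.rfl

theorem RecSeq.map {F : (ℕ → ℕ) → ℕ → ℕ} {x : I → ℕ → ℕ} (hF : IsRec (τ := Ty.one ⇒ Ty.one) F)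
    (hx : RecSeq E x) : RecSeq E fun i => F (x i) :=
  Rec.app (σ := Ty.one) (τ := Ty.one) hF.rec hx

theorem RecSeq.entry {s : I → ℕ → ℕ} (hs : RecSeq E s) (hf : RecNat E f) :
    RecSeq E fun i => entry (s i) (f i) :=
  RecSeq.lam (RecSeq.app (F := fun j : Tot Ty.nat × I => s j.2) hs.weaken
    (RecNat.succ (RecNat.pair hf.weaken Rec.var)))

/-- `Rec` for values of type `2`. -/
abbrev RecFunc {I : Type} {Γ : List Ty} (E : I → Env Γ) (f : I → (ℕ → ℕ) → ℕ) : Prop :=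
  Rec (τ := Ty.two) E f

theorem RecFunc.app {G : I → (ℕ → ℕ) → ℕ} {x : I → ℕ → ℕ} (hG : RecFunc E G)
    (hx : RecSeq E x) : RecNat E fun i => G i (x i) :=
  Rec.app (σ := Ty.one) (τ := Ty.nat) hG hx

theorem RecFunc.lam {G : I → (ℕ → ℕ) → ℕ} (hG : RecNat (bindTot Ty.one E) fun j => G j.2 j.1) :
    RecFunc E G :=
  Rec.lam (σ := Ty.one) (τ := Ty.nat) hG

theorem RecFunc.map {F : ((ℕ → ℕ) → ℕ) → (ℕ → ℕ) → ℕ} {G : I → (ℕ → ℕ) → ℕ}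
    (hF : IsRec (τ := Ty.two ⇒ Ty.two) F) (hG : RecFunc E G) : RecFunc E fun i => F (G i) :=
  Rec.app (σ := Ty.two) (τ := Ty.two) hF.rec hG

theorem isRec_id : IsRec (τ := Ty.one ⇒ Ty.one) fun x => x := Rec.lam Rec.var

/-- The characteristic function of the graph of a function, as a subset of `ℕ` by pairing. -/
noncomputable def graphChr (x : ℕ → ℕ) (n : ℕ) : ℕ := ind (x n.unpair.1 = n.unpair.2)

theorem RecNat.graphChr {x : I → ℕ → ℕ} (hx : RecSeq E x) (hf : RecNat E f) :
    RecNat E fun i => graphChr (x i) (f i) :=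
  RecPred.eq (RecSeq.app hx hf.left) hf.right

/-- The function with a given characteristic function of the graph. -/
noncomputable def ofGraphChr (g : ℕ → ℕ) (k : ℕ) : ℕ := sInf {m | g (Nat.pair k m) = 1}

theorem isRec_ofGraphChr : IsRec (τ := Ty.one ⇒ Ty.one) ofGraphChr :=
  Rec.lam (RecSeq.lam (RecNat.nat_sInf (RecPred.eq
    (RecSeq.app Rec.var.weaken.weaken (RecNat.pair Rec.var.weaken Rec.var)) (.const 1))))

@[simp]
theorem ofGraphChr_graphChr (x : ℕ → ℕ) : ofGraphChr (graphChr x) = x := by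
  funext k
  have hset : {m | graphChr x (Nat.pair k m) = 1} = {x k} := by
    ext m
    rw [Set.mem_ofPred_eq, graphChr, ind_eq_one, Nat.unpair_pair]
    exact eq_comm
  rw [ofGraphChr, hset, csInf_singleton]

end Closure

/-! ### Computations with a partial functional as oracle -/

section Oracle

variable {α σ τ : Ty}

/-- The assignment of `φ` to a single variable. -/
def oracle (φ : Par σ) (_ : Unit) : Env [σ] := (φ, ())

theorem definable_oracle (φ : Par σ) : Definable (oracle φ) fun _ => φ := ⟨.var .zero, fun _ => rfl⟩

theorem Definable.computableModE2 {φ : Par σ} {M ψ : Par τ}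
    (hM : Definable (oracle φ) fun _ => M) (hψ : ψ ≤ M) : ComputableModE2 ψ φ := by
  obtain ⟨t, ht⟩ := hM
  exact ⟨t, hψ.trans_eq (ht ()).symm⟩

theorem computable_of_query {φ : Par (Ty.two ⇒ α)} {ψ : Par (Ty.two ⇒ τ)}
    {prep : Tot (Ty.two ⇒ Ty.two)} {post : Tot (Ty.two ⇒ α ⇒ τ)}
    (hprep : IsRec prep) (hpost : IsRec post)
    (h : ∀ G, ψ G ≠ ⊥ → ∃ y : Tot α, φ (prep G) = toPar y ∧ ψ G = toPar (post G y))
    (hτ : (Ty.two ⇒ τ).rank ≤ 3 := by decide) : ComputableModE2 ψ φ := by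
  have hM := Definable.lam (f := fun (_ : Unit) G => Par.app (toPar (post G)) (φ (prep G)))
    (Definable.papp (Rec.app hpost.rec Rec.var) (Definable.app (definable_oracle φ).weaken
      (Rec.app hprep.rec Rec.var))) hτ
  refine hM.computableModE2 (Par.le_of_ne_bot fun G hG => ?_)
  obtain ⟨y, hy, hψ⟩ := h G hG
  rw [hψ]
  exact ((congrArg (Par.app _) hy).trans (Par.app_toPar (toPar (post G)) y)).ge

theorem computable_of_queries {φ : Par (Ty.two ⇒ α)} {ψ : Par (Ty.two ⇒ τ)}
    {prep : Tot (Ty.two ⇒ Ty.nat ⇒ Ty.two)} {post : Tot (Ty.two ⇒ (Ty.nat ⇒ α) ⇒ τ)}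
    (hprep : IsRec prep) (hpost : IsRec post)
    (h : ∀ G, ψ G ≠ ⊥ → ∃ y : Tot (Ty.nat ⇒ α),
      (∀ n, φ (prep G n) = toPar (y n)) ∧ ψ G = toPar (post G y))
    (hα : (Ty.nat ⇒ α).rank ≤ 3 := by decide) (hτ : (Ty.two ⇒ τ).rank ≤ 3 := by decide) :
    ComputableModE2 ψ φ := by
  let query (G : Tot Ty.two) : Par (Ty.nat ⇒ α) := fun n => φ (prep G n)
  have hq : Definable (bindTot Ty.two (oracle φ)) fun p => query p.1 :=
    Definable.lam (Definable.app (definable_oracle φ).weaken.weaken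
      (Rec.app (Rec.app hprep.rec Rec.var.weaken) Rec.var :) :) hα
  have hM := Definable.lam (f := fun (_ : Unit) G => Par.app (toPar (post G)) (query G))
    (Definable.papp (Rec.app hpost.rec Rec.var) hq) hτ
  refine hM.computableModE2 (Par.le_of_ne_bot fun G hG => ?_)
  obtain ⟨y, hy, hψ⟩ := h G hG
  rw [hψ]
  refine (Eq.trans ?_ (Par.app_toPar (toPar (post G)) y)).ge
  exact congrArg (Par.app _) (funext hy)

theorem computable_of_queries₂ {φ : Par (Ty.two ⇒ α)} {ψ : Par (Ty.two ⇒ Ty.two ⇒ τ)}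
    {prep : Tot (Ty.two ⇒ Ty.two ⇒ Ty.nat ⇒ Ty.two)}
    {post : Tot (Ty.two ⇒ Ty.two ⇒ (Ty.nat ⇒ α) ⇒ τ)}
    (hprep : IsRec prep) (hpost : IsRec post)
    (h : ∀ G H, ψ G H ≠ ⊥ → ∃ y : Tot (Ty.nat ⇒ α),
      (∀ n, φ (prep G H n) = toPar (y n)) ∧ ψ G H = toPar (post G H y))
    (hα : (Ty.nat ⇒ α).rank ≤ 3 := by decide)
    (hτ : (Ty.two ⇒ Ty.two ⇒ τ).rank ≤ 3 := by decide) :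
    ComputableModE2 ψ φ := by
  let query (G H : Tot Ty.two) : Par (Ty.nat ⇒ α) := fun n => φ (prep G H n)
  have hq : Definable (bindTot Ty.two (bindTot Ty.two (oracle φ))) fun p => query p.2.1 p.1 :=
    Definable.lam (Definable.app (definable_oracle φ).weaken.weaken.weaken
      (Rec.app (Rec.app (Rec.app hprep.rec Rec.var.weaken.weaken) Rec.var.weaken) Rec.var :) :) hα
  let M : Par (Ty.two ⇒ Ty.two ⇒ τ) := fun G H => Par.app (toPar (post G H)) (query G H)
  have hM : Definable (oracle φ) fun _ => M := Definable.lam (Definable.lam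
    (Definable.papp (Rec.app (Rec.app hpost.rec Rec.var.weaken) Rec.var) hq)
    ((le_max_right _ _).trans hτ)) hτ
  refine hM.computableModE2 fun G => Par.le_of_ne_bot fun H hGH => ?_
  obtain ⟨y, hy, hψ⟩ := h G H hGH
  rw [hψ]
  refine (Eq.trans ?_ (Par.app_toPar (toPar (post G H)) y)).ge
  exact congrArg (Par.app _) (funext hy)

theorem computable_of_query₂ {φ : Par (Ty.two ⇒ Ty.two ⇒ α)} {ψ : Par (Ty.two ⇒ τ)}
    {prep₁ : Tot (Ty.two ⇒ Ty.two)} {prep₂ : Tot Ty.two} {post : Tot (α ⇒ τ)}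
    (hprep₁ : IsRec prep₁) (hprep₂ : IsRec prep₂) (hpost : IsRec post)
    (h : ∀ G, ψ G ≠ ⊥ → ∃ y : Tot α, φ (prep₁ G) prep₂ = toPar y ∧ ψ G = toPar (post y))
    (hτ : (Ty.two ⇒ τ).rank ≤ 3 := by decide) :
    ComputableModE2 ψ φ := by
  have hM := Definable.lam
    (f := fun (_ : Unit) G => Par.app (toPar post) (φ (prep₁ G) prep₂))
    (Definable.papp hpost.rec (Definable.app (Definable.app (definable_oracle φ).weaken
      (Rec.app hprep₁.rec Rec.var)) hprep₂.rec)) hτ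
  refine hM.computableModE2 (Par.le_of_ne_bot fun G hG => ?_)
  obtain ⟨y, hy, hψ⟩ := h G hG
  rw [hψ]
  exact ((congrArg (Par.app _) hy).trans (Par.app_toPar (toPar post) y)).ge

theorem exists_definable_recursion (φ : Par (Ty.two ⇒ Ty.one))
    {A : Tot Ty.two → Tot Ty.one → ℕ} {rem : Tot (Ty.two ⇒ Ty.one ⇒ Ty.two)}
    {B : Tot (Ty.one ⇒ Ty.one ⇒ Ty.nat)} {post : Tot (Ty.one ⇒ Ty.one)}
    (hA : IsRec (τ := Ty.two ⇒ Ty.one ⇒ Ty.nat) A) (hrem : IsRec rem) (hB : IsRec B)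
    (hpost : IsRec post) :
    ∃ M : Par (Ty.two ⇒ Ty.one), Definable (oracle φ) (fun _ => M) ∧
      ∀ G, M G = Par.app (toPar post) (Par.app φ fun s => if A G s = 0
        then toPar (σ := Ty.nat) (0 : ℕ) else Par.app (toPar (B s)) (M (rem G s))) := by
  let F (u : Par (Ty.two ⇒ Ty.one)) (_ : Unit) : Par (Ty.two ⇒ Ty.one) := fun G =>
    Par.app (toPar post) (Par.app φ fun s => if A G s = 0
      then toPar (σ := Ty.nat) (0 : ℕ) else Par.app (toPar (B s)) (u (rem G s)))
  have hF : Definable (bindPar (Ty.two ⇒ Ty.one) (oracle φ)) fun p => F p.1 p.2 :=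
    Definable.lam (Definable.papp hpost.rec (Definable.papp (definable_oracle φ).weakenPar.weaken
      (Definable.lam (Definable.caseNat (Rec.app (Rec.app hA.rec Rec.var.weaken) Rec.var)
        (RecNat.const 0) (Definable.papp (Rec.app hB.rec Rec.var)
          (Definable.app Definable.var.weaken.weaken
            (Rec.app (Rec.app hrem.rec Rec.var.weaken) Rec.var)))))))
  obtain ⟨M, hM, hfix⟩ := Definable.exists_fixedPoint hF
  exact ⟨M (), hM, fun G => congrFun (hfix ()) G⟩

/-- The query made for `G` depends on the values of `ψ` at the smaller inputs `rem G s`. -/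
theorem computable_of_recursion {φ ψ : Par (Ty.two ⇒ Ty.one)}
    {A : Tot Ty.two → Tot Ty.one → ℕ} {rem : Tot (Ty.two ⇒ Ty.one ⇒ Ty.two)}
    {B : Tot Ty.one → Tot Ty.one → ℕ} {post : Tot (Ty.one ⇒ Ty.one)}
    (hA : IsRec (τ := Ty.two ⇒ Ty.one ⇒ Ty.nat) A) (hrem : IsRec rem)
    (hB : IsRec (τ := Ty.one ⇒ Ty.one ⇒ Ty.nat) B) (hpost : IsRec post)
    (dom : Tot Ty.two → Prop) (μ : Tot Ty.two → ℕ) (val : Tot Ty.two → Tot Ty.one)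
    (hrec : ∀ G, dom G → ∀ s, A G s ≠ 0 → dom (rem G s) ∧ μ (rem G s) < μ G)
    (hval : ∀ G, dom G → ∃ y, φ (fun s => if A G s = 0 then (0 : ℕ) else
      B s (val (rem G s))) = toPar y ∧ val G = post y)
    (hψ : ∀ G, ψ G ≠ ⊥ → dom G ∧ ψ G = toPar (val G)) : ComputableModE2 ψ φ := by
  obtain ⟨M, hM, hfix⟩ := exists_definable_recursion φ hA hrem hB hpost
  have hMval (G : Tot Ty.two) (hG : dom G) : M G = toPar (val G) := by
    induction h : μ G using Nat.strong_induction_on generalizing G with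
    | h n ih =>
      subst h
      obtain ⟨y, hy, hv⟩ := hval G hG
      let query : Tot Ty.two := fun s => if A G s = 0 then (0 : ℕ) else B s (val (rem G s))
      have hquery : (fun s => if A G s = 0 then toPar (σ := Ty.nat) (0 : ℕ) else
          Par.app (toPar (σ := Ty.one ⇒ Ty.nat) (B s)) (M (rem G s))) = toPar query := by
        refine funext fun s => ?_
        by_cases hs : A G s = 0
        · exact (if_pos hs).trans (congrArg (toPar (σ := Ty.nat)) (if_pos hs).symm)
        · obtain ⟨hdom, hlt⟩ := hrec G hG s hs
          refine (if_neg hs).trans (Eq.trans ?_ (congrArg (toPar (σ := Ty.nat)) (if_neg hs).symm))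
          rw [ih _ hlt _ hdom rfl]
          exact Par.app_toPar (toPar (σ := Ty.one ⇒ Ty.nat) (B s)) _
      rw [hfix, hquery, Par.app_toPar, hv]
      exact (congrArg (Par.app _) hy).trans (Par.app_toPar (toPar post) y)
  refine hM.computableModE2 (Par.le_of_ne_bot fun G hG => ?_)
  obtain ⟨hdom, hψG⟩ := hψ G hG
  exact (hψG.trans (hMval G hdom).symm).le

end Oracle

/-! ### Names of real numbers -/

section Rational

variable {I : Type} {Γ : List Ty} {E : I → Env Γ} {a b c : I → ℕ}

theorem ratOf_lt_add_iff (a b c : ℕ) : ratOf a < ratOf b + ratOf c ↔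
    a.unpair.1.unpair.1 * ((b.unpair.2 + 1) * (c.unpair.2 + 1)) +
      b.unpair.1.unpair.2 * ((a.unpair.2 + 1) * (c.unpair.2 + 1)) +
      c.unpair.1.unpair.2 * ((a.unpair.2 + 1) * (b.unpair.2 + 1)) <
    a.unpair.1.unpair.2 * ((b.unpair.2 + 1) * (c.unpair.2 + 1)) +
      b.unpair.1.unpair.1 * ((a.unpair.2 + 1) * (c.unpair.2 + 1)) +
      c.unpair.1.unpair.1 * ((a.unpair.2 + 1) * (b.unpair.2 + 1)) := by
  unfold ratOf
  rw [div_add_div _ _ (by positivity) (by positivity), div_lt_div_iff₀ (by positivity)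
    (by positivity), ← Nat.cast_lt (α := ℚ)]
  push_cast
  constructor <;> intro h <;> linarith

theorem exists_ratOf_eq (q : ℚ) : ∃ m, ratOf m = q := by
  refine ⟨Nat.pair (Nat.pair q.num.toNat (-q.num).toNat) (q.den - 1), ?_⟩
  have hden : ((q.den - 1 : ℕ) : ℚ) + 1 = q.den := by
    rw [← Nat.cast_succ, Nat.succ_eq_add_one, Nat.sub_add_cancel q.den_pos]
  have hnum : ((q.num.toNat : ℕ) : ℚ) - ((-q.num).toNat : ℕ) = q.num := by
    exact_mod_cast Int.toNat_sub_toNat_neg q.num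
  simp only [ratOf, Nat.unpair_pair]
  rw [hden, hnum, Rat.num_div_den]

/-- The code of the fraction `k / d`, for `d ≠ 0`. -/
def frac (k d : ℕ) : ℕ := Nat.pair (Nat.pair k 0) (d - 1)

theorem ratOf_frac (k : ℕ) {d : ℕ} (hd : 0 < d) : ratOf (frac k d) = k / d := by
  have hden : ((d - 1 : ℕ) : ℚ) + 1 = d := by
    rw [← Nat.cast_succ, Nat.succ_eq_add_one, Nat.sub_add_cancel hd]
  simp [ratOf, frac, hden]

theorem cast_ratOf_frac (k : ℕ) {d : ℕ} (hd : 0 < d) : (ratOf (frac k d) : ℝ) = k / d := by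
  rw [ratOf_frac k hd, Rat.cast_div, Rat.cast_natCast, Rat.cast_natCast]

theorem RecPred.ratOf_lt_add (ha : RecNat E a) (hb : RecNat E b) (hc : RecNat E c) :
    RecPred E fun i => ratOf (a i) < ratOf (b i) + ratOf (c i) := by
  have hden {f g : I → ℕ} (hf : RecNat E f) (hg : RecNat E g) :
      RecNat E fun i => ((f i).unpair.2 + 1) * ((g i).unpair.2 + 1) :=
    hf.right.succ.mul hg.right.succ
  exact (RecPred.lt
    (((ha.left.left.mul (hden hb hc)).add (hb.left.right.mul (hden ha hc))).add
      (hc.left.right.mul (hden ha hb)))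
    (((ha.left.right.mul (hden hb hc)).add (hb.left.left.mul (hden ha hc))).add
      (hc.left.left.mul (hden ha hb)))).of_iff fun _ => (ratOf_lt_add_iff _ _ _).symm

theorem RecPred.abs_ratOf_sub_lt (ha : RecNat E a) (hb : RecNat E b) (hc : RecNat E c) :
    RecPred E fun i => |ratOf (a i) - ratOf (b i)| < ratOf (c i) :=
  ((RecPred.ratOf_lt_add ha hb hc).and (RecPred.ratOf_lt_add hb ha hc)).of_iff fun _ => by
    rw [abs_sub_lt_iff, sub_lt_iff_lt_add', sub_lt_iff_lt_add']

theorem RecNat.frac (ha : RecNat E a) (hb : RecNat E b) : RecNat E fun i => frac (a i) (b i) :=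
  RecNat.pair (RecNat.pair ha .zero) hb.pred

end Rational

/-- Fast converging Cauchy sequences of rationals. -/
def IsFast (x : ℕ → ℕ) : Prop :=
  ∀ n i : ℕ, |ratOf (x n) - ratOf (x (n + i))| < 1 / 2 ^ n

theorem IsFast.exists_codesReal {x : ℕ → ℕ} (h : IsFast x) : ∃ r, CodesReal x r := by
  have hc : CauchySeq fun n => (ratOf (x n) : ℝ) := by
    refine cauchySeq_of_le_geometric (1 / 2) 1 (by norm_num) fun n => ?_
    rw [Real.dist_eq, one_mul, one_div_pow]
    have hlt := (Rat.cast_le (K := ℝ)).2 (h n 1).le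
    push_cast at hlt
    exact hlt
  exact (cauchySeq_tendsto_of_complete hc).imp fun r hr => ⟨h, hr⟩

theorem isRec_isFast : IsRec (τ := Ty.two) fun x => ind (IsFast x) := by
  have hpow (n : ℕ) : ratOf (frac 1 (2 ^ n)) = 1 / 2 ^ n := by
    rw [ratOf_frac 1 (Nat.two_pow_pos n)]
    push_cast
    rfl
  refine Rec.lam (RecPred.all (RecPred.all ?_))
  refine (RecPred.abs_ratOf_sub_lt (RecSeq.app Rec.var.weaken.weaken Rec.var.weaken)
    (RecSeq.app Rec.var.weaken.weaken (RecNat.add Rec.var.weaken Rec.var))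
    (RecNat.frac (.const 1) (RecNat.pow (.const 2) Rec.var.weaken))).of_iff fun p => ?_
  exact iff_of_eq (congrArg _ (hpow p.2.1))

theorem tendsto_two_div_two_pow :
    Filter.Tendsto (fun n : ℕ => (2 : ℝ) / 2 ^ n) Filter.atTop (nhds 0) := by
  have h := (tendsto_pow_atTop_nhds_zero_of_lt_one (r := (1 / 2 : ℝ)) (by norm_num)
    (by norm_num)).const_mul 2
  rw [mul_zero] at h
  exact h.congr fun n => by rw [one_div_pow, mul_one_div]

section CodesReal

variable {x : ℕ → ℕ} {r : ℝ}

theorem CodesReal.unique {s : ℝ} (hr : CodesReal x r) (hs : CodesReal x s) : r = s :=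
  tendsto_nhds_unique hr.2 hs.2

theorem CodesReal.abs_sub_lt (h : CodesReal x r) (n : ℕ) :
    |(ratOf (x n) : ℝ) - r| < 2 / 2 ^ n := by
  have ht : Filter.Tendsto (fun i => |(ratOf (x n) : ℝ) - ratOf (x (i + n))|) Filter.atTop
      (nhds |(ratOf (x n) : ℝ) - r|) :=
    (tendsto_const_nhds.sub ((Filter.tendsto_add_atTop_iff_nat n).2 h.2)).abs
  refine (le_of_tendsto' ht (b := 1 / 2 ^ n) fun i => ?_).trans_lt (by gcongr; norm_num)
  rw [add_comm i n]
  have hle := (Rat.cast_le (K := ℝ)).2 (h.1 n i).le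
  push_cast at hle
  exact hle

theorem CodesReal.abs_sub_le_iff (h : CodesReal x r) (s ε : ℝ) :
    |s - r| ≤ ε ↔ ∀ k, |s - ratOf (x k)| < ε + 2 / 2 ^ k := by
  refine ⟨fun hs k => ?_, fun hk => ?_⟩
  · calc |s - ratOf (x k)| ≤ |s - r| + |r - ratOf (x k)| := abs_sub_le _ _ _
      _ < ε + 2 / 2 ^ k := add_lt_add_of_le_of_lt hs (abs_sub_comm r _ ▸ h.abs_sub_lt k)
  · have hε := tendsto_two_div_two_pow.const_add ε
    rw [add_zero] at hε
    exact le_of_tendsto_of_tendsto' (tendsto_const_nhds.sub h.2).abs hε fun k => (hk k).le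

theorem CodesReal.le_iff (h : CodesReal x r) (s : ℝ) :
    r ≤ s ↔ ∀ k, (ratOf (x k) : ℝ) < s + 2 / 2 ^ k := by
  refine ⟨fun hs k => ?_, fun hk => ?_⟩
  · linarith [(abs_lt.1 (h.abs_sub_lt k)).2]
  · have hs := tendsto_two_div_two_pow.const_add s
    rw [add_zero] at hs
    exact le_of_tendsto_of_tendsto' h.2 hs fun k => (hk k).le

theorem CodesReal.ge_iff (h : CodesReal x r) (s : ℝ) :
    s ≤ r ↔ ∀ k, s < ratOf (x k) + 2 / 2 ^ k := by
  refine ⟨fun hs k => ?_, fun hk => ?_⟩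
  · linarith [(abs_lt.1 (h.abs_sub_lt k)).1]
  · have hs := h.2.add tendsto_two_div_two_pow
    rw [add_zero] at hs
    exact ge_of_tendsto' hs fun k => (hk k).le

end CodesReal

/-- The canonical name of a real number: its `n`-th term is the least code of a rational at
distance at most `1 / 2 ^ (n + 2)`. -/
noncomputable def realName (r : ℝ) (n : ℕ) : ℕ :=
  sInf {m | |(ratOf m : ℝ) - r| ≤ 1 / 2 ^ (n + 2)}

theorem abs_ratOf_realName_sub_le (r : ℝ) (n : ℕ) :
    |(ratOf (realName r n) : ℝ) - r| ≤ 1 / 2 ^ (n + 2) := by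
  refine Nat.sInf_mem (s := {m | |(ratOf m : ℝ) - r| ≤ 1 / 2 ^ (n + 2)}) ?_
  obtain ⟨q, hrq, hq⟩ := exists_rat_btwn (lt_add_of_pos_right r
    (by positivity : (0 : ℝ) < 1 / 2 ^ (n + 2)))
  obtain ⟨m, rfl⟩ := exists_ratOf_eq q
  exact ⟨m, (abs_le.2 ⟨by linarith, by linarith⟩ : |(ratOf m : ℝ) - r| ≤ _)⟩

theorem codesReal_realName (r : ℝ) : CodesReal (realName r) r := by
  have hle (n i : ℕ) : (1 : ℝ) / 2 ^ (n + i + 2) ≤ 1 / 2 ^ (n + 2) :=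
    one_div_le_one_div_of_le (by positivity) (pow_le_pow_right₀ one_le_two (by omega))
  have hpow (n : ℕ) : (1 : ℝ) / 2 ^ n = 4 * (1 / 2 ^ (n + 2)) := by
    rw [pow_add]
    field_simp
    norm_num
  have hpos (n : ℕ) : (0 : ℝ) < 1 / 2 ^ (n + 2) := by positivity
  refine ⟨fun n i => ?_, ?_⟩
  · rw [← Rat.cast_lt (K := ℝ)]
    push_cast
    have hn := abs_le.1 (abs_ratOf_realName_sub_le r n)
    have hni := abs_le.1 (abs_ratOf_realName_sub_le r (n + i))
    rw [abs_lt]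
    constructor <;> linarith [hle n i, hpow n, hpos n]
  · rw [tendsto_iff_norm_sub_tendsto_zero]
    refine squeeze_zero (fun _ => norm_nonneg _) (fun n => ?_) tendsto_two_div_two_pow
    refine (abs_ratOf_realName_sub_le r n).trans ?_
    linarith [hpow n, hpos n, show (2 : ℝ) / 2 ^ n = 2 * (1 / 2 ^ n) by ring]

/-- The canonical name of a real number, computed from an arbitrary name of it. -/
noncomputable def canReal (z : ℕ → ℕ) (n : ℕ) : ℕ :=
  sInf {m | ∀ k, |ratOf m - ratOf (z k)| <
    ratOf (frac (2 ^ k + 2 ^ (n + 3)) (2 ^ (n + 2 + k)))}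

theorem canReal_eq {z : ℕ → ℕ} {r : ℝ} (h : CodesReal z r) : canReal z = realName r := by
  funext n
  refine congrArg sInf (Set.ext fun m => ?_)
  have hfrac (k : ℕ) : (ratOf (frac (2 ^ k + 2 ^ (n + 3)) (2 ^ (n + 2 + k))) : ℝ) =
      1 / 2 ^ (n + 2) + 2 / 2 ^ k := by
    rw [cast_ratOf_frac _ (by positivity)]
    push_cast
    field_simp
    ring
  change _ ↔ |(ratOf m : ℝ) - r| ≤ _
  rw [h.abs_sub_le_iff]
  refine forall_congr' fun k => ?_
  rw [← hfrac]
  norm_cast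

theorem isRec_canReal : IsRec (τ := Ty.one ⇒ Ty.one) canReal := by
  refine Rec.lam (RecSeq.lam (RecNat.nat_sInf (RecPred.all ?_)))
  have hn : RecNat (bindTot Ty.nat (bindTot Ty.nat (bindTot Ty.nat (bindTot Ty.one (Γ := []) id))))
      fun p => p.2.2.1 := Rec.var.weaken.weaken
  exact RecPred.abs_ratOf_sub_lt Rec.var.weaken (RecSeq.app Rec.var.weaken.weaken.weaken Rec.var)
    (RecNat.frac (RecNat.add (RecNat.pow (.const 2) Rec.var)
      (RecNat.pow (.const 2) (hn.add (.const 3))))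
      (RecNat.pow (.const 2) (RecNat.add (hn.add (.const 2)) Rec.var)))

/-- A condition on a name of a real number: the number lies in `[0,1]`. -/
def InUnit (z : ℕ → ℕ) : Prop :=
  ∀ k, ratOf (frac 0 1) < ratOf (z k) + ratOf (frac 2 (2 ^ k)) ∧
    ratOf (z k) < ratOf (frac 1 1) + ratOf (frac 2 (2 ^ k))

theorem isRec_inUnit : IsRec (τ := Ty.two) fun x => ind (InUnit x) := by
  refine Rec.lam (RecPred.all (RecPred.and ?_ ?_))
  · exact RecPred.ratOf_lt_add (.const _) (RecSeq.app Rec.var.weaken Rec.var)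
      (RecNat.frac (.const 2) (RecNat.pow (.const 2) Rec.var))
  · exact RecPred.ratOf_lt_add (RecSeq.app Rec.var.weaken Rec.var) (.const _)
      (RecNat.frac (.const 2) (RecNat.pow (.const 2) Rec.var))

theorem inUnit_iff {z : ℕ → ℕ} {r : ℝ} (h : CodesReal z r) : InUnit z ↔ r ∈ unitInterval := by
  rw [unitInterval, Set.mem_Icc, h.le_iff, h.ge_iff, ← forall_and]
  refine forall_congr' fun k => ?_
  simp only [← Rat.cast_lt (K := ℝ), Rat.cast_add, cast_ratOf_frac _ one_pos,
    cast_ratOf_frac _ (Nat.two_pow_pos k), Nat.cast_pow, Nat.cast_ofNat, Nat.cast_zero,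
    Nat.cast_one, div_one]

/-- The integer part of `3 ^ n * r`, computed from a name `z` of the real number `r ≥ 0`. -/
noncomputable def ternaryFloor (z : ℕ → ℕ) (n : ℕ) : ℕ :=
  sInf {k | ¬ ∀ j, ratOf (frac (k + 1) (3 ^ n)) < ratOf (z j) + ratOf (frac 2 (2 ^ j))}

theorem isRec_ternaryFloor : IsRec (τ := Ty.one ⇒ Ty.one) ternaryFloor := by
  refine Rec.lam (RecSeq.lam (RecNat.nat_sInf (RecPred.not (RecPred.all ?_))))
  exact RecPred.ratOf_lt_add
    (RecNat.frac (RecNat.succ Rec.var.weaken) (RecNat.pow (.const 3) Rec.var.weaken.weaken))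
    (RecSeq.app Rec.var.weaken.weaken.weaken Rec.var)
    (RecNat.frac (.const 2) (RecNat.pow (.const 2) Rec.var))

theorem RecNat.ternaryFloor {I : Type} {Γ : List Ty} {E : I → Env Γ} {z : I → ℕ → ℕ} {n : I → ℕ}
    (hz : RecSeq E z) (hn : RecNat E n) : RecNat E fun i => ternaryFloor (z i) (n i) :=
  RecSeq.app (RecSeq.map isRec_ternaryFloor hz) hn

theorem ternaryFloor_eq {z : ℕ → ℕ} {r : ℝ} (h : CodesReal z r) (hr : 0 ≤ r) (n : ℕ) :
    ternaryFloor z n = ⌊3 ^ n * r⌋₊ := by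
  have hset : {k | ¬ ∀ j, ratOf (frac (k + 1) (3 ^ n)) < ratOf (z j) + ratOf (frac 2 (2 ^ j))} =
      Set.Ici ⌊3 ^ n * r⌋₊ := by
    ext k
    simp only [Set.mem_ofPred_eq, Set.mem_Ici, ← Rat.cast_lt (K := ℝ), Rat.cast_add,
      cast_ratOf_frac 2 (Nat.two_pow_pos _), Nat.cast_pow, Nat.cast_ofNat]
    rw [← h.ge_iff, not_le, cast_ratOf_frac _ (by positivity), ← Nat.lt_succ_iff,
      Nat.floor_lt (by positivity), lt_div_iff₀ (by positivity), mul_comm]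
    push_cast
    rfl
  rw [ternaryFloor, hset, csInf_Ici]

/-! ### Ternary expansions -/

section Ternary

variable {k : ℕ → ℕ}

theorem ratOf_frac_three_pow_bounds (h₁ : ∀ n, 3 * k n ≤ k (n + 1))
    (h₂ : ∀ n, k (n + 1) ≤ 3 * k n + 2) (n i : ℕ) :
    ratOf (frac (k n) (3 ^ n)) ≤ ratOf (frac (k (n + i)) (3 ^ (n + i))) ∧
      ratOf (frac (k (n + i)) (3 ^ (n + i))) < ratOf (frac (k n) (3 ^ n)) + 1 / 3 ^ n := by
  have hnat : 3 ^ i * k n ≤ k (n + i) ∧ k (n + i) + 1 ≤ 3 ^ i * (k n + 1) := by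
    induction i with
    | zero => simp
    | succ i ih =>
      rw [pow_succ, ← add_assoc, mul_comm (3 ^ i), mul_assoc, mul_assoc]
      have := h₁ (n + i)
      have := h₂ (n + i)
      omega
  have hrat : (3 : ℚ) ^ i * k n ≤ k (n + i) ∧ (k (n + i) : ℚ) + 1 ≤ 3 ^ i * (k n + 1) := by
    exact_mod_cast hnat
  rw [ratOf_frac _ (by positivity), ratOf_frac _ (by positivity)]
  push_cast
  rw [pow_add, ← add_div, div_le_div_iff₀ (by positivity) (by positivity),
    div_lt_div_iff₀ (by positivity) (by positivity)]
  constructor <;> nlinarith [show (0 : ℚ) < 3 ^ n by positivity]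

theorem isFast_ternary (h₁ : ∀ n, 3 * k n ≤ k (n + 1)) (h₂ : ∀ n, k (n + 1) ≤ 3 * k n + 2) :
    IsFast fun n => frac (k n) (3 ^ n) := fun n i => by
  obtain ⟨hle, hlt⟩ := ratOf_frac_three_pow_bounds h₁ h₂ n i
  have hpow : (1 : ℚ) / 3 ^ n ≤ 1 / 2 ^ n :=
    one_div_le_one_div_of_le (by positivity) (pow_le_pow_left₀ (by norm_num) (by norm_num) n)
  rw [abs_lt]
  constructor <;> linarith [show (0 : ℚ) < 1 / 2 ^ n by positivity]

theorem exists_codesReal_ternary (h₁ : ∀ n, 3 * k n ≤ k (n + 1))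
    (h₂ : ∀ n, k (n + 1) ≤ 3 * k n + 2) :
    ∃ r : ℝ, CodesReal (fun n => frac (k n) (3 ^ n)) r ∧
      ∀ n, (k n : ℝ) ≤ 3 ^ n * r ∧ 3 ^ n * r ≤ k n + 1 := by
  obtain ⟨r, hr⟩ := (isFast_ternary h₁ h₂).exists_codesReal
  refine ⟨r, hr, fun n => ?_⟩
  have ht := (Filter.tendsto_add_atTop_iff_nat n).2 hr.2
  have hbd (i : ℕ) : (k n / 3 ^ n : ℝ) ≤ ratOf (frac (k (i + n)) (3 ^ (i + n))) ∧
      (ratOf (frac (k (i + n)) (3 ^ (i + n))) : ℝ) ≤ (k n + 1) / 3 ^ n := by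
    obtain ⟨hle, hlt⟩ := ratOf_frac_three_pow_bounds h₁ h₂ n i
    rw [ratOf_frac (k n) (by positivity), add_comm n i] at hle hlt
    have hle' := (Rat.cast_le (K := ℝ)).2 hle
    have hlt' := (Rat.cast_le (K := ℝ)).2 hlt.le
    push_cast at hle' hlt'
    rw [add_div]
    exact ⟨hle', hlt'⟩
  have hpos : (0 : ℝ) < 3 ^ n := by positivity
  exact ⟨(div_le_iff₀' hpos).1 (ge_of_tendsto' ht fun i => (hbd i).1),
    (le_div_iff₀' hpos).1 (le_of_tendsto' ht fun i => (hbd i).2)⟩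

theorem le_of_forall_three_pow {a b : ℝ} (h : ∀ n : ℕ, 3 ^ n * a ≤ 3 ^ n * b + 1) : a ≤ b := by
  by_contra! hab
  obtain ⟨n, hn⟩ := pow_unbounded_of_one_lt (1 / (a - b)) (show (1 : ℝ) < 3 by norm_num)
  rw [div_lt_iff₀ (sub_pos.2 hab)] at hn
  linarith [h n]

end Ternary

/-! ### An embedding of the Baire space into the unit interval -/

/-- The number whose ternary digits are the first `n` values of the characteristic function of the
graph of `x`. -/
noncomputable def graphDigits (x : ℕ → ℕ) (n : ℕ) : ℕ :=
  Nat.rec 0 (fun i a => 3 * a + graphChr x i) n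

theorem graphDigits_succ (x : ℕ → ℕ) (n : ℕ) :
    graphDigits x (n + 1) = 3 * graphDigits x n + graphChr x n := rfl

/-- A name of the real number `embReal x`. -/
noncomputable def embRealName (x : ℕ → ℕ) (n : ℕ) : ℕ := frac (graphDigits x n) (3 ^ n)

theorem isRec_embRealName : IsRec (τ := Ty.one ⇒ Ty.one) embRealName := by
  refine Rec.lam (RecSeq.lam (RecNat.frac (RecNat.natRec .zero ?_ Rec.var)
    (RecNat.pow (.const 3) Rec.var)))
  exact RecNat.add (RecNat.mul (.const 3) Rec.var)
    (RecNat.graphChr Rec.var.weaken.weaken.weaken Rec.var.weaken)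

theorem exists_embReal (x : ℕ → ℕ) : ∃ r : ℝ, CodesReal (embRealName x) r ∧
    ∀ n, (graphDigits x n : ℝ) ≤ 3 ^ n * r ∧ 3 ^ n * r ≤ graphDigits x n + 1 := by
  refine exists_codesReal_ternary (fun n => ?_) fun n => ?_ <;> rw [graphDigits_succ]
  · exact Nat.le_add_right _ _
  · exact Nat.add_le_add_left ((ind_le_one _).trans one_le_two) _

/-- The embedding of the Baire space into the middle third Cantor set, up to the factor `2`: the
ternary digits of `embReal x` are the values of the characteristic function of the graph of `x`. -/
noncomputable def embReal (x : ℕ → ℕ) : ℝ := (exists_embReal x).choose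

theorem codesReal_embReal (x : ℕ → ℕ) : CodesReal (embRealName x) (embReal x) :=
  (exists_embReal x).choose_spec.1

theorem embReal_bounds (x : ℕ → ℕ) (n : ℕ) : (graphDigits x n : ℝ) ≤ 3 ^ n * embReal x ∧
    3 ^ n * embReal x ≤ graphDigits x n + 2 / 3 := by
  refine ⟨((exists_embReal x).choose_spec.2 n).1, ?_⟩
  have hub : 3 ^ (n + 1) * embReal x ≤ graphDigits x (n + 1) + 1 :=
    ((exists_embReal x).choose_spec.2 (n + 1)).2
  have hdigit : (graphDigits x (n + 1) : ℝ) ≤ 3 * graphDigits x n + 1 := by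
    rw [graphDigits_succ]
    exact_mod_cast Nat.add_le_add_left (ind_le_one _) _
  rw [pow_succ] at hub
  linarith

theorem embReal_mem (x : ℕ → ℕ) : embReal x ∈ unitInterval := by
  obtain ⟨hlb, hub⟩ := embReal_bounds x 0
  rw [show graphDigits x 0 = 0 from rfl, pow_zero, one_mul, Nat.cast_zero] at hlb hub
  exact ⟨hlb, by linarith⟩

theorem ternaryFloor_embReal {z x : ℕ → ℕ} (h : CodesReal z (embReal x)) (n : ℕ) :
    ternaryFloor z n = graphDigits x n := by
  have hnonneg := (embReal_mem x).1
  obtain ⟨hlb, hub⟩ := embReal_bounds x n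
  rw [ternaryFloor_eq h hnonneg, Nat.floor_eq_iff (by positivity)]
  exact ⟨hlb, by linarith⟩

/-- The inverse of `embReal`, on names. -/
noncomputable def decReal (z : ℕ → ℕ) : ℕ → ℕ :=
  ofGraphChr fun n => ternaryFloor z (n + 1) - 3 * ternaryFloor z n

theorem isRec_decReal : IsRec (τ := Ty.one ⇒ Ty.one) decReal := by
  refine Rec.lam (RecSeq.map (F := ofGraphChr) isRec_ofGraphChr (RecSeq.lam ?_))
  exact RecNat.sub (RecNat.ternaryFloor Rec.var.weaken (RecNat.succ Rec.var))
    (RecNat.mul (.const 3) (RecNat.ternaryFloor Rec.var.weaken Rec.var))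

theorem decReal_eq {z x : ℕ → ℕ} (h : CodesReal z (embReal x)) : decReal z = x := by
  simp only [decReal, ternaryFloor_embReal h, graphDigits_succ, Nat.add_sub_cancel_left,
    ofGraphChr_graphChr]

/-! ### Reductions between a domain and the Baire space -/

/-- Data that identify a domain with a subset of the Baire space and the Baire space with a subset
of the domain, computably in `∃²`: every point `p` has a canonical name `cname p`, which `can`
computes from any name of `p`, and `emb` is an embedding of the Baire space into the domain,
computed by `embName` and inverted, on names, by `dec`. -/
structure DomCode (D : Dom) where
  can : (ℕ → ℕ) → ℕ → ℕ
  can_rec : IsRec (τ := Ty.one ⇒ Ty.one) can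
  cname : D.Pt → ℕ → ℕ
  names_cname : ∀ p, D.Names (cname p) p
  can_eq : ∀ {x p}, D.Names x p → can x = cname p
  names_unique : ∀ {x p q}, D.Names x p → D.Names x q → p = q
  isName : (ℕ → ℕ) → Prop
  isName_rec : IsRec (τ := Ty.two) fun x => ind (isName x)
  isName_iff : ∀ x, isName x ↔ ∃ p, D.Names x p
  emb : (ℕ → ℕ) → D.Pt
  embName : (ℕ → ℕ) → ℕ → ℕ
  embName_rec : IsRec (τ := Ty.one ⇒ Ty.one) embName
  names_emb : ∀ x, D.Names (embName x) (emb x)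
  dec : (ℕ → ℕ) → ℕ → ℕ
  dec_rec : IsRec (τ := Ty.one ⇒ Ty.one) dec
  dec_eq : ∀ {z x}, D.Names z (emb x) → dec z = x

/-- The coding of the Baire space in itself. -/
def baireCode : DomCode .baire where
  can x := x
  can_rec := isRec_id
  cname p := p
  names_cname _ := rfl
  can_eq h := h
  names_unique h h' := Eq.trans (Eq.symm h) h'
  isName _ := True
  isName_rec := RecFunc.lam ((RecNat.const 1).of_eq fun _ => (ind_true trivial).symm)
  isName_iff x := ⟨fun _ => ⟨x, rfl⟩, fun _ => trivial⟩
  emb x := x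
  embName x := x
  embName_rec := isRec_id
  names_emb _ := rfl
  dec x := x
  dec_rec := isRec_id
  dec_eq h := h

open Classical in
/-- The coding of the Cantor space; functions are embedded by their graphs. -/
noncomputable def cantorCode : DomCode .cantor where
  can x := x
  can_rec := isRec_id
  cname (p : ℕ → Bool) n := (p n).toNat
  names_cname _ _ := rfl
  can_eq h := funext h
  names_unique {x} {p q : ℕ → Bool} h h' := funext fun n =>
    (by decide : Function.Injective Bool.toNat) ((h n).symm.trans (h' n))
  isName x := ∀ n, x n ≤ 1
  isName_rec :=
    RecFunc.lam (RecPred.all (RecPred.le (RecSeq.app Rec.var.weaken Rec.var) (.const 1)))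
  isName_iff x := by
    refine ⟨fun h => ⟨fun n => decide (x n = 1), fun n => ?_⟩, ?_⟩
    · rcases Nat.le_one_iff_eq_zero_or_eq_one.1 (h n) with h | h <;> simp [h]
    · rintro ⟨p, hp⟩ n
      rw [hp n]
      exact Bool.toNat_le _
  emb x n := decide (x n.unpair.1 = n.unpair.2)
  embName := graphChr
  embName_rec := Rec.lam (RecSeq.lam (RecNat.graphChr Rec.var.weaken Rec.var))
  names_emb x n := by by_cases h : x n.unpair.1 = n.unpair.2 <;> simp [graphChr, ind, h]
  dec := ofGraphChr
  dec_rec := isRec_ofGraphChr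
  dec_eq {z x} h := by
    have hz : z = graphChr x := funext fun n => (h n).trans (by
      by_cases h : x n.unpair.1 = n.unpair.2 <;> simp [graphChr, ind, h])
    rw [hz, ofGraphChr_graphChr]

/-- The coding of the real line. -/
noncomputable def lineCode : DomCode .line where
  can := canReal
  can_rec := isRec_canReal
  cname := realName
  names_cname := codesReal_realName
  can_eq := canReal_eq
  names_unique := CodesReal.unique
  isName := IsFast
  isName_rec := isRec_isFast
  isName_iff _ := ⟨IsFast.exists_codesReal, fun ⟨_, h⟩ => h.1⟩
  emb := embReal
  embName := embRealName
  embName_rec := isRec_embRealName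
  names_emb := codesReal_embReal
  dec := decReal
  dec_rec := isRec_decReal
  dec_eq := decReal_eq

/-- The coding of the unit interval. -/
noncomputable def unitCode : DomCode .unit where
  can := canReal
  can_rec := isRec_canReal
  cname (p : unitInterval) := realName p.1
  names_cname p := codesReal_realName _
  can_eq := canReal_eq
  names_unique h h' := Subtype.ext (CodesReal.unique h h')
  isName x := IsFast x ∧ InUnit x
  isName_rec := RecFunc.lam (RecPred.and (RecFunc.app isRec_isFast.rec Rec.var)
    (RecFunc.app isRec_inUnit.rec Rec.var))
  isName_iff x := by
    constructor
    · rintro ⟨hfast, hunit⟩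
      obtain ⟨r, hr⟩ := hfast.exists_codesReal
      exact ⟨(⟨r, (inUnit_iff hr).1 hunit⟩ : unitInterval), hr⟩
    · rintro ⟨p, hp⟩
      exact ⟨hp.1, (inUnit_iff hp).2 p.2⟩
  emb x := (⟨embReal x, embReal_mem x⟩ : unitInterval)
  embName := embRealName
  embName_rec := isRec_embRealName
  names_emb := codesReal_embReal
  dec := decReal
  dec_rec := isRec_decReal
  dec_eq := decReal_eq

/-- The coding of each of the four domains. -/
noncomputable def domCode : (D : Dom) → DomCode D
  | .baire => baireCode
  | .cantor => cantorCode
  | .unit => unitCode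
  | .line => lineCode

/-- The characteristic function of a subset of the Baire space. -/
noncomputable def chr (X : Set (ℕ → ℕ)) (x : ℕ → ℕ) : ℕ := ind (x ∈ X)

/-- The set that is coded by a type `2` object. -/
def ones (G : (ℕ → ℕ) → ℕ) : Set (ℕ → ℕ) := {x | G x = 1}

@[simp]
theorem ones_chr (X : Set (ℕ → ℕ)) : ones (chr X) = X := Set.ext fun _ => ind_eq_one

theorem RecPred.mem_ones {I : Type} {Γ : List Ty} {E : I → Env Γ} {G : I → (ℕ → ℕ) → ℕ}
    {x : I → ℕ → ℕ} (hG : RecFunc E G) (hx : RecSeq E x) : RecPred E fun i => x i ∈ ones (G i) :=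
  RecPred.eq (RecFunc.app hG hx) (.const 1)

namespace Dom

variable {D : Dom} {G : Tot Ty.two} {X : Set D.Pt} {x : ℕ → ℕ} {p : D.Pt}

open Classical in
theorem RepSet.apply (h : D.RepSet G X) (hx : D.Names x p) : G x = ind (p ∈ X) := by
  rw [h x p hx, Set.indicator_apply, ind]

open Classical in
theorem RepSet.of_forall (h : ∀ x p, D.Names x p → G x = ind (p ∈ X)) : D.RepSet G X :=
  fun x p hx => by rw [h x p hx, Set.indicator_apply, ind]

theorem RepSet.apply_eq_one_iff (h : D.RepSet G X) (hx : D.Names x p) : G x = (1 : ℕ) ↔ p ∈ X :=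
  (iff_of_eq (congrArg (· = (1 : ℕ)) (h.apply hx))).trans ind_eq_one

end Dom

namespace DomCode

variable {D : Dom} (c : DomCode D)

theorem cname_injective : Function.Injective c.cname := fun p q h =>
  c.names_unique (c.names_cname p) (h ▸ c.names_cname q)

theorem dec_cname_emb (x : ℕ → ℕ) : c.dec (c.cname (c.emb x)) = x := c.dec_eq (c.names_cname _)

theorem emb_injective : Function.Injective c.emb := fun x y h => by
  rw [← c.dec_cname_emb x, h, c.dec_cname_emb]

theorem mem_range_cname (x : ℕ → ℕ) : x ∈ Set.range c.cname ↔ c.isName x ∧ c.can x = x := by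
  rw [c.isName_iff]
  constructor
  · rintro ⟨p, rfl⟩
    exact ⟨⟨p, c.names_cname p⟩, c.can_eq (c.names_cname p)⟩
  · rintro ⟨⟨p, hp⟩, hx⟩
    exact ⟨p, (c.can_eq hp).symm.trans hx⟩

/-- The characteristic function of the set of canonical names of the elements of a set. -/
noncomputable def canon (G : (ℕ → ℕ) → ℕ) (x : ℕ → ℕ) : ℕ :=
  ind ((c.isName x ∧ c.can x = x) ∧ x ∈ ones G)

theorem isRec_canon : IsRec (τ := Ty.two ⇒ Ty.two) c.canon := by
  refine Rec.lam (RecFunc.lam (RecPred.and (RecPred.and ?_ ?_) ?_))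
  · exact RecFunc.app c.isName_rec.rec Rec.var
  · exact RecPred.funEq (RecSeq.map c.can_rec Rec.var) Rec.var
  · exact RecPred.mem_ones Rec.var.weaken Rec.var

theorem canon_eq {G : Tot Ty.two} {X : Set D.Pt} (h : D.RepSet G X) :
    c.canon G = chr (c.cname '' X) := by
  funext x
  refine ind_congr ?_
  rw [← c.mem_range_cname]
  constructor
  · rintro ⟨⟨p, rfl⟩, hG⟩
    exact ⟨p, (h.apply_eq_one_iff (c.names_cname p)).1 hG, rfl⟩
  · rintro ⟨p, hp, rfl⟩
    exact ⟨⟨p, rfl⟩, (h.apply_eq_one_iff (c.names_cname p)).2 hp⟩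

/-- A representative of the image of a subset of the Baire space in the domain. -/
noncomputable def push (G : (ℕ → ℕ) → ℕ) (z : ℕ → ℕ) : ℕ :=
  ind (c.can z = c.can (c.embName (c.dec z)) ∧ c.dec z ∈ ones G)

theorem isRec_push : IsRec (τ := Ty.two ⇒ Ty.two) c.push := by
  refine Rec.lam (RecFunc.lam (RecPred.and (RecPred.funEq ?_ ?_) ?_))
  · exact RecSeq.map c.can_rec Rec.var
  · exact RecSeq.map c.can_rec (RecSeq.map c.embName_rec (RecSeq.map c.dec_rec Rec.var))
  · exact RecPred.mem_ones Rec.var.weaken (RecSeq.map c.dec_rec Rec.var)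

theorem repSet_push (X : Set (ℕ → ℕ)) : D.RepSet (c.push (chr X)) (c.emb '' X) := by
  refine Dom.RepSet.of_forall fun z p hz => ind_congr ⟨?_, ?_⟩
  · rintro ⟨hcan, hdec⟩
    rw [c.can_eq hz, c.can_eq (c.names_emb _)] at hcan
    exact ⟨c.dec z, ind_eq_one.1 hdec, (c.cname_injective hcan).symm⟩
  · rintro ⟨x, hx, rfl⟩
    rw [c.dec_eq hz, c.can_eq hz, c.can_eq (c.names_emb x)]
    exact ⟨rfl, ind_true hx⟩

/-- A representative of the function `p ↦ (dec p) i` on the domain. -/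
noncomputable def coord (i : ℕ) (z : ℕ → ℕ) : ℕ := c.dec (c.can z) i

theorem isRec_coord (i : ℕ) : IsRec (τ := Ty.two) (c.coord i) :=
  RecFunc.lam (RecSeq.app (RecSeq.map c.dec_rec (RecSeq.map c.can_rec Rec.var)) (.const i))

theorem repFun_coord (i : ℕ) : D.RepFun (c.coord i) fun p => c.dec (c.cname p) i := fun _ _ hx =>
  congrArg (fun z => c.dec z i) (c.can_eq hx)

end DomCode

/-! ### Codes of finite subsets of the Baire space -/

/-- The set of the entries of the finite sequence coded by `s`. -/
def entries (s : ℕ → ℕ) : Set (ℕ → ℕ) := Set.range fun i : Fin (s 0) => entry s i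

/-- The code of a finite sequence of type `1` objects. -/
def seqCode {n : ℕ} (f : Fin n → ℕ → ℕ) : ℕ → ℕ
  | 0 => n
  | k + 1 => if h : k.unpair.1 < n then f ⟨k.unpair.1, h⟩ k.unpair.2 else 0

theorem entry_seqCode {n : ℕ} (f : Fin n → ℕ → ℕ) (i : Fin n) : entry (seqCode f) i = f i := by
  funext k
  simp [entry, seqCode]

/-- The canonical codes of finite sets: `s` codes a sequence that is strictly increasing in the
lexicographic order, and vanishes at the arguments that do not belong to an entry. -/
def IsSorted (s : ℕ → ℕ) : Prop :=
  (∀ j, j < s 0 → ∀ i, i < j → toLex (entry s i) < toLex (entry s j)) ∧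
    ∀ k, s 0 ≤ k.unpair.1 → s (k + 1) = 0

theorem isRec_isSorted : IsRec (τ := Ty.two) fun s => ind (IsSorted s) := by
  refine RecFunc.lam (RecPred.and ?_ ?_)
  · refine RecPred.all (RecPred.imp (RecPred.lt Rec.var (RecSeq.app Rec.var.weaken .zero))
      (RecPred.all (RecPred.imp (RecPred.lt Rec.var Rec.var.weaken) (RecPred.toLex_lt ?_ ?_))))
    · exact RecSeq.entry Rec.var.weaken.weaken Rec.var
    · exact RecSeq.entry Rec.var.weaken.weaken Rec.var.weaken
  · exact RecPred.all (RecPred.imp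
      (RecPred.le (RecSeq.app Rec.var.weaken .zero) (RecNat.left Rec.var))
      (RecPred.eq (RecSeq.app Rec.var.weaken (RecNat.succ Rec.var)) .zero))

theorem isSorted_seqCode {n : ℕ} {f : Fin n → ℕ → ℕ} (hf : StrictMono fun i => toLex (f i)) :
    IsSorted (seqCode f) := by
  refine ⟨fun j hj i hij => ?_, fun k hk => dif_neg hk.not_gt⟩
  rw [entry_seqCode f ⟨i, hij.trans hj⟩, entry_seqCode f ⟨j, hj⟩]
  exact hf hij

namespace IsSorted

variable {s t : ℕ → ℕ}

theorem strictMono (h : IsSorted s) : StrictMono fun i : Fin (s 0) => toLex (entry s i) :=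
  fun i j hij => h.1 j j.2 i hij

theorem encard_entries (h : IsSorted s) : (entries s).encard = s 0 := by
  have hinj : Function.Injective fun i : Fin (s 0) => entry s i := h.strictMono.injective
  rw [entries, ← Set.image_univ, hinj.encard_image, Set.encard_univ, ENat.card_eq_coe_fintype_card,
    Fintype.card_fin]

theorem seqCode_entry (h : IsSorted s) : seqCode (fun i : Fin (s 0) => entry s i) = s := by
  funext k
  cases k with
  | zero => rfl
  | succ k =>
    by_cases hk : k.unpair.1 < s 0
    · simp [seqCode, hk, entry]
    · simp [seqCode, hk, h.2 k (not_lt.1 hk)]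

theorem ext (hs : IsSorted s) (ht : IsSorted t) (h : entries s = entries t) : s = t := by
  have hlen : s 0 = t 0 := by
    have hcard := congrArg Set.encard h
    rwa [hs.encard_entries, ht.encard_entries, Nat.cast_inj] at hcard
  suffices hentry : ∀ {m n : ℕ} (f : Fin m → ℕ → ℕ) (g : Fin n → ℕ → ℕ), m = n →
      (StrictMono fun i => toLex (f i)) → (StrictMono fun i => toLex (g i)) →
      Set.range f = Set.range g → seqCode f = seqCode g by
    rw [← hs.seqCode_entry, ← ht.seqCode_entry]
    exact hentry _ _ hlen hs.strictMono ht.strictMono h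
  rintro m _ f g rfl hf hg hfg
  exact congrArg seqCode ((hf.range_inj hg).1 hfg)

end IsSorted

theorem exists_isSorted {X : Set (ℕ → ℕ)} (hX : X.Finite) : ∃ s, IsSorted s ∧ entries s = X := by
  let S : Finset (Lex (ℕ → ℕ)) := hX.toFinset.map toLex.toEmbedding
  let f : Fin S.card → ℕ → ℕ := fun i => ofLex (S.orderEmbOfFin rfl i)
  refine ⟨seqCode f, isSorted_seqCode (S.orderEmbOfFin rfl).strictMono, ?_⟩
  have hrange : Set.range f = ofLex '' (S : Set (Lex (ℕ → ℕ))) := by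
    rw [← S.range_orderEmbOfFin rfl, ← Set.range_comp]
    rfl
  calc entries (seqCode f) = Set.range f := congrArg Set.range (funext (entry_seqCode f))
    _ = X := by rw [hrange]; ext x; simp [S]

open Classical in
/-- The sorted code of a finite set; infinite sets get the code of the empty sequence. -/
noncomputable def sortCode (X : Set (ℕ → ℕ)) : ℕ → ℕ :=
  if h : X.Finite then (exists_isSorted h).choose else fun _ => 0

section SortCode

variable {X : Set (ℕ → ℕ)}

theorem isSorted_sortCode (h : X.Finite) : IsSorted (sortCode X) := by
  rw [sortCode, dif_pos h]
  exact (exists_isSorted h).choose_spec.1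

theorem entries_sortCode (h : X.Finite) : entries (sortCode X) = X := by
  rw [sortCode, dif_pos h]
  exact (exists_isSorted h).choose_spec.2

theorem encard_eq_sortCode_zero (h : X.Finite) : X.encard = sortCode X 0 := by
  rw [← (isSorted_sortCode h).encard_entries, entries_sortCode h]

theorem eq_sortCode_iff (h : X.Finite) {s : ℕ → ℕ} :
    s = sortCode X ↔ IsSorted s ∧ (∀ i, i < s 0 → entry s i ∈ X) ∧ X.encard = s 0 := by
  constructor
  · rintro rfl
    refine ⟨isSorted_sortCode h, fun i hi => ?_, encard_eq_sortCode_zero h⟩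
    exact (entries_sortCode h).subset ⟨⟨i, hi⟩, rfl⟩
  · rintro ⟨hs, hmem, hcard⟩
    have hsub : entries s ⊆ X := by
      rintro _ ⟨i, rfl⟩
      exact hmem i i.2
    have heq : entries s = X :=
      (h.subset hsub).eq_of_subset_of_encard_le hsub (by rw [hcard, hs.encard_entries])
    exact hs.ext (isSorted_sortCode h) (heq.trans (entries_sortCode h).symm)

theorem sortCode_zero_eq_zero (h : X.Finite) : sortCode X 0 = 0 ↔ X = ∅ := by
  rw [← Set.encard_eq_zero, encard_eq_sortCode_zero h, Nat.cast_eq_zero]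

theorem sortCode_empty : sortCode ∅ = fun _ => 0 :=
  ((eq_sortCode_iff Set.finite_empty).2 ⟨⟨fun j hj => absurd hj (Nat.not_lt_zero j),
    fun _ _ => rfl⟩, fun i hi => absurd hi (Nat.not_lt_zero i), by simp⟩).symm

end SortCode

/-- The code of a one-element sequence. -/
def single (x : ℕ → ℕ) : ℕ → ℕ
  | 0 => 1
  | k + 1 => if k.unpair.1 = 0 then x k.unpair.2 else 0

theorem isRec_single : IsRec (τ := Ty.one ⇒ Ty.one) single := by
  have hk : RecNat (bindTot Ty.nat (bindTot Ty.one (Γ := []) (id : Unit → Env []))) fun p => p.1 :=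
    Rec.var
  refine Rec.lam (RecSeq.lam (RecNat.of_eq (RecNat.cond hk (.const 1) (RecNat.cond hk.pred.left
    (RecSeq.app Rec.var.weaken hk.pred.right) .zero)) ?_))
  rintro ⟨_ | k, x, _⟩ <;> rfl

theorem entry_single (x : ℕ → ℕ) : entry (single x) 0 = x := by
  funext k
  simp [entry, single]

theorem sortCode_singleton (x : ℕ → ℕ) : sortCode {x} = single x := by
  refine ((eq_sortCode_iff (Set.finite_singleton x)).2 ⟨⟨fun j hj i hi => ?_, fun k hk => ?_⟩,
    fun i hi => ?_, Set.encard_singleton x⟩).symm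
  · change j < 1 at hj
    omega
  · exact if_neg (Nat.one_le_iff_ne_zero.1 hk)
  · obtain rfl : i = 0 := Nat.lt_one_iff.1 hi
    exact entry_single x

/-! ### The functionals on subsets of the Baire space -/

/-- The type `1` object `x` without its first value. -/
def tail (x : ℕ → ℕ) (n : ℕ) : ℕ := x (n + 1)

/-- The type `1` object with first value `a` and tail `x`. -/
def cons (a : ℕ) (x : ℕ → ℕ) : ℕ → ℕ
  | 0 => a
  | n + 1 => x n

theorem eq_of_tail_eq {x y : ℕ → ℕ} (h0 : x 0 = y 0) (h : tail x = tail y) : x = y := by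
  funext n
  cases n
  · exact h0
  · exact congrFun h _

theorem eq_cons_iff {a : ℕ} {x y : ℕ → ℕ} : y = cons a x ↔ y 0 = a ∧ tail y = x := by
  constructor
  · rintro rfl
    exact ⟨rfl, rfl⟩
  · rintro ⟨rfl, rfl⟩
    exact eq_of_tail_eq rfl rfl

theorem RecSeq.tail {I : Type} {Γ : List Ty} {E : I → Env Γ} {x : I → ℕ → ℕ} (hx : RecSeq E x) :
    RecSeq E fun i => tail (x i) :=
  RecSeq.lam (RecSeq.app (F := fun j : Tot Ty.nat × I => x j.2)
    (f := fun j : Tot Ty.nat × I => Nat.succ j.1) hx.weaken (RecNat.succ Rec.var))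

open Classical in
/-- The functional that is defined at the characteristic functions of the subsets of the Baire
space that satisfy `dom`, with values `val`. -/
noncomputable def hub {τ : Ty} (dom : Set (ℕ → ℕ) → Prop) (val : Set (ℕ → ℕ) → Tot τ) :
    Par (Ty.two ⇒ τ) := fun G =>
  if G = chr (ones G) ∧ dom (ones G) then toPar (val (ones G)) else ⊥

section Hub

variable {τ : Ty} {dom : Set (ℕ → ℕ) → Prop} {val : Set (ℕ → ℕ) → Tot τ}

theorem hub_chr {X : Set (ℕ → ℕ)} (h : dom X) : hub dom val (chr X) = toPar (val X) := by
  have hX : ones (chr X) = X := ones_chr X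
  exact (if_pos ⟨by rw [hX], by rwa [hX]⟩).trans (congrArg (fun Z => toPar (val Z)) hX)

theorem exists_of_hub_ne_bot {G : Tot Ty.two} (h : hub dom val G ≠ ⊥) : ∃ X, dom X ∧ G = chr X := by
  by_contra hn
  exact h (if_neg fun hG => hn ⟨ones G, hG.2, hG.1⟩)

end Hub

/-- Decides whether a set with at most one element is nonempty. -/
noncomputable def nonemptyHub : Par (Ty.two ⇒ Ty.nat) :=
  hub (fun X => X.encard ≤ 1) fun X => ind X.Nonempty

/-- Sorted codes of sets with at most one element. -/
noncomputable def subsingletonHub : Par (Ty.two ⇒ Ty.one) := hub (fun X => X.encard ≤ 1) sortCode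

/-- Sorted codes of finite sets. -/
noncomputable def finiteHub : Par (Ty.two ⇒ Ty.one) := hub Set.Finite sortCode

/-- Decides whether the element of a singleton starts with `0`. -/
noncomputable def bitHub : Par (Ty.two ⇒ Ty.nat) :=
  hub (fun X => ∃ x, X = {x}) fun X => ind (∃ x ∈ X, x 0 = 0)

open Classical in
/-- The element of a singleton, and an arbitrary value for other sets. -/
noncomputable def point (X : Set (ℕ → ℕ)) : ℕ → ℕ :=
  if h : X.Nonempty then h.some else fun _ => 0

theorem point_singleton (x : ℕ → ℕ) : point {x} = x := by
  rw [point, dif_pos (Set.singleton_nonempty x)]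
  exact (Set.singleton_nonempty x).some_mem

/-- The element of a singleton. -/
noncomputable def singletonHub : Par (Ty.two ⇒ Ty.one) := hub (fun X => ∃ x, X = {x}) point

/-- The subsets of `X` whose nonemptiness determines `X`, when `X` has at most one element:
`X` itself, and the set of the elements whose graph contains a given pair. -/
def graphSlice (X : Set (ℕ → ℕ)) (n : ℕ) : Set (ℕ → ℕ) :=
  {x | x ∈ X ∧ (n = 0 ∨ graphChr x (n - 1) = 1)}

theorem isRec_graphSlice :
    IsRec (τ := Ty.two ⇒ Ty.nat ⇒ Ty.two) fun G n => chr (graphSlice (ones G) n) := by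
  refine Rec.lam (Rec.lam (RecFunc.lam (RecPred.and ?_ (RecPred.or ?_ ?_))))
  · exact RecPred.mem_ones Rec.var.weaken.weaken Rec.var
  · exact RecPred.eq Rec.var.weaken .zero
  · exact RecPred.eq (RecNat.graphChr Rec.var (RecNat.pred Rec.var.weaken)) (.const 1)

/-- The sorted code of a set with at most one element, from the answers to the questions whether its
graph slices are nonempty. -/
noncomputable def sortCodeOfSlices (y : ℕ → ℕ) (k : ℕ) : ℕ :=
  if y 0 = 0 then 0 else single (ofGraphChr (tail y)) k

theorem isRec_sortCodeOfSlices : IsRec (τ := Ty.one ⇒ Ty.one) sortCodeOfSlices := by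
  refine Rec.lam (RecSeq.lam (RecNat.cond (RecSeq.app Rec.var.weaken .zero) .zero ?_))
  exact RecSeq.app
    (RecSeq.map isRec_single (RecSeq.map isRec_ofGraphChr (RecSeq.tail Rec.var.weaken))) Rec.var

theorem sortCodeOfSlices_nonempty {X : Set (ℕ → ℕ)} (hX : X.encard ≤ 1) :
    sortCodeOfSlices (fun n => ind (graphSlice X n).Nonempty) = sortCode X := by
  rcases Set.encard_le_one_iff_eq.1 hX with rfl | ⟨x, rfl⟩
  · rw [sortCode_empty]
    exact funext fun k => if_pos (ind_false fun ⟨x, hx⟩ => hx.1)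
  · have hzero : ind (graphSlice {x} 0).Nonempty ≠ 0 := by
      rw [ind_true ⟨x, rfl, Or.inl rfl⟩]
      exact one_ne_zero
    have htail : tail (fun n => ind (graphSlice {x} n).Nonempty) = graphChr x := by
      funext n
      refine ind_congr ⟨?_, fun h => ⟨x, rfl, Or.inr (ind_true h)⟩⟩
      rintro ⟨_, rfl, h | h⟩
      · exact absurd h n.succ_ne_zero
      · exact ind_eq_one.1 h
    funext k
    rw [sortCodeOfSlices, if_neg hzero, htail, ofGraphChr_graphChr, sortCode_singleton]

theorem subsingletonHub_le : ComputableModE2 subsingletonHub nonemptyHub := by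
  refine computable_of_queries (α := Ty.nat) (post := fun _ => sortCodeOfSlices) isRec_graphSlice
    (Rec.lam isRec_sortCodeOfSlices.rec) fun G hG => ?_
  obtain ⟨X, hX, rfl⟩ := exists_of_hub_ne_bot hG
  refine ⟨fun n => ind (graphSlice X n).Nonempty, fun n => ?_, ?_⟩
  · rw [ones_chr]
    exact hub_chr ((Set.encard_le_encard fun x hx => hx.1).trans hX)
  · exact (hub_chr hX).trans (congrArg (toPar (σ := Ty.one)) (sortCodeOfSlices_nonempty hX).symm)

theorem eq_sortCode_iff_sdiff {X : Set (ℕ → ℕ)} (hX : X.Finite) {s : ℕ → ℕ} :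
    ((s 0 ≠ 0 ∧ IsSorted s ∧ ∀ i, i < s 0 → entry s i ∈ X) ∧
      sortCode (X \ {entry s 0}) 0 + 1 = s 0) ↔ X.Nonempty ∧ s = sortCode X := by
  have hcard (h : entry s 0 ∈ X) : X.encard = sortCode (X \ {entry s 0}) 0 + 1 := by
    rw [← encard_eq_sortCode_zero hX.sdiff, Set.encard_sdiff_singleton_add_one h]
  rw [eq_sortCode_iff hX]
  constructor
  · rintro ⟨⟨h0, hs, hmem⟩, hlen⟩
    have h0mem := hmem 0 (Nat.pos_of_ne_zero h0)
    exact ⟨⟨_, h0mem⟩, hs, hmem, by rw [hcard h0mem, ← hlen, Nat.cast_add, Nat.cast_one]⟩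
  · rintro ⟨hne, hs, hmem, hlen⟩
    have h0 : s 0 ≠ 0 := fun h =>
      hne.ne_empty (Set.encard_eq_zero.1 (by rw [hlen, h, Nat.cast_zero]))
    refine ⟨⟨h0, hs, hmem⟩, ?_⟩
    rw [hcard (hmem 0 (Nat.pos_of_ne_zero h0))] at hlen
    exact_mod_cast hlen

/-- The first entry of the sequence coded by `y`, and the code of the empty sequence if `y` codes
the empty sequence. -/
def firstEntry (y : ℕ → ℕ) (k : ℕ) : ℕ := if y 0 = 0 then 0 else entry y 0 k

theorem isRec_firstEntry : IsRec (τ := Ty.one ⇒ Ty.one) firstEntry :=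
  Rec.lam (RecSeq.lam (RecNat.cond (RecSeq.app Rec.var.weaken .zero) .zero
    (RecSeq.app (RecSeq.entry Rec.var.weaken .zero) Rec.var)))

theorem firstEntry_sortCode (X : Set (ℕ → ℕ)) :
    firstEntry (sortCode {s | X.Nonempty ∧ s = sortCode X}) = sortCode X := by
  rcases X.eq_empty_or_nonempty with rfl | hX
  · have h : {s | (∅ : Set (ℕ → ℕ)).Nonempty ∧ s = sortCode ∅} = ∅ :=
      Set.eq_empty_of_forall_notMem fun s hs => Set.not_nonempty_empty hs.1
    rw [h, sortCode_empty]
    rfl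
  · have h : {s | X.Nonempty ∧ s = sortCode X} = {sortCode X} :=
      Set.ext fun s => and_iff_right hX
    rw [h, sortCode_singleton]
    exact funext fun k => (if_neg one_ne_zero).trans (congrFun (entry_single _) k)

theorem isRec_sdiff_entry :
    IsRec (τ := Ty.two ⇒ Ty.one ⇒ Ty.two) fun G s => chr (ones G \ {entry s 0}) := by
  refine Rec.lam (Rec.lam (RecFunc.lam (RecPred.and ?_ (RecPred.not ?_))))
  · exact RecPred.mem_ones Rec.var.weaken.weaken Rec.var
  · exact RecPred.funEq Rec.var (RecSeq.entry Rec.var.weaken .zero)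

theorem isRec_isSorted_mem : IsRec (τ := Ty.two ⇒ Ty.one ⇒ Ty.nat) fun G (s : ℕ → ℕ) =>
    ind (s 0 ≠ 0 ∧ IsSorted s ∧ ∀ i, i < s 0 → entry s i ∈ ones G) := by
  refine Rec.lam (RecFunc.lam (RecPred.and ?_ (RecPred.and ?_ (RecPred.all (RecPred.imp ?_ ?_)))))
  · exact RecPred.not (RecPred.eq (RecSeq.app Rec.var .zero) .zero)
  · exact RecFunc.app isRec_isSorted.rec Rec.var
  · exact RecPred.lt Rec.var (RecSeq.app Rec.var.weaken .zero)
  · exact RecPred.mem_ones Rec.var.weaken.weaken (RecSeq.entry Rec.var.weaken Rec.var)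

theorem isRec_length_succ_eq :
    IsRec (τ := Ty.one ⇒ Ty.one ⇒ Ty.nat) fun (s t : ℕ → ℕ) => ind (t 0 + 1 = s 0) :=
  Rec.lam (RecFunc.lam (RecPred.eq (RecNat.succ (RecSeq.app Rec.var .zero))
    (RecSeq.app Rec.var.weaken .zero)))

/-- By recursion on the cardinality: the sorted code of `X` is the element of the set
`{s | X.Nonempty ∧ s = sortCode X}`, in which membership of `s` depends only on the length of the
sorted code of `X \ {entry s 0}`. -/
theorem finiteHub_le : ComputableModE2 finiteHub subsingletonHub := by
  refine computable_of_recursion isRec_isSorted_mem isRec_sdiff_entry isRec_length_succ_eq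
    isRec_firstEntry (fun G => (ones G).Finite) (fun G => (ones G).ncard)
    (fun G => sortCode (ones G)) ?_ ?_ ?_
  · intro G hG s hs
    obtain ⟨h0, -, hmem⟩ := of_not_not (mt ind_false hs)
    rw [ones_chr]
    exact ⟨hG.sdiff,
      Set.ncard_sdiff_singleton_lt_of_mem (hmem 0 (Nat.pos_of_ne_zero h0)) hG⟩
  · intro G hG
    refine ⟨sortCode {s | (ones G).Nonempty ∧ s = sortCode (ones G)}, ?_,
      (firstEntry_sortCode _).symm⟩
    refine Eq.trans (congrArg subsingletonHub ?_) (hub_chr ?_)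
    · funext s
      rw [ones_chr]
      exact (ite_ind_eq_zero _ _).trans (ind_congr (eq_sortCode_iff_sdiff hG))
    · refine Set.encard_le_one_iff.2 ?_
      rintro _ _ ⟨-, rfl⟩ ⟨-, rfl⟩
      rfl
  · intro G hG
    obtain ⟨X, hX, rfl⟩ := exists_of_hub_ne_bot hG
    rw [ones_chr]
    exact ⟨hX, hub_chr hX⟩

/-- The set of the sequences `y` with `tail y ∈ X` whose first value is `0` if and only if
the graph of `tail y` contains the pair coded by `n`. -/
def graphFlag (X : Set (ℕ → ℕ)) (n : ℕ) : Set (ℕ → ℕ) :=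
  {y | tail y ∈ X ∧ y 0 = 1 - graphChr (tail y) n}

theorem isRec_graphFlag :
    IsRec (τ := Ty.two ⇒ Ty.nat ⇒ Ty.two) fun G n => chr (graphFlag (ones G) n) := by
  refine Rec.lam (Rec.lam (RecFunc.lam (RecPred.and ?_ (RecPred.eq ?_ (RecNat.sub (.const 1) ?_)))))
  · exact RecPred.mem_ones Rec.var.weaken.weaken (RecSeq.tail Rec.var)
  · exact RecSeq.app Rec.var .zero
  · exact RecNat.graphChr (RecSeq.tail Rec.var) Rec.var.weaken

theorem graphFlag_singleton (x : ℕ → ℕ) (n : ℕ) :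
    graphFlag {x} n = {cons (1 - graphChr x n) x} := by
  ext y
  rw [Set.mem_singleton_iff, eq_cons_iff]
  constructor
  · rintro ⟨rfl, h⟩
    exact ⟨h, rfl⟩
  · rintro ⟨h, rfl⟩
    exact ⟨rfl, h⟩

theorem exists_mem_graphFlag_singleton (x : ℕ → ℕ) (n : ℕ) :
    (∃ y ∈ graphFlag {x} n, y 0 = 0) ↔ x n.unpair.1 = n.unpair.2 := by
  rw [graphFlag_singleton]
  by_cases h : x n.unpair.1 = n.unpair.2 <;> simp [cons, graphChr, ind, h]

theorem singletonHub_le : ComputableModE2 singletonHub bitHub := by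
  refine computable_of_queries (α := Ty.nat) (post := fun _ => ofGraphChr) isRec_graphFlag
    (Rec.lam isRec_ofGraphChr.rec) fun G hG => ?_
  obtain ⟨_, ⟨x, rfl⟩, rfl⟩ := exists_of_hub_ne_bot hG
  refine ⟨graphChr x, fun n => ?_, ?_⟩
  · rw [ones_chr]
    exact (hub_chr ⟨_, graphFlag_singleton x n⟩).trans
      (congrArg (toPar (σ := Ty.nat)) (ind_congr (exists_mem_graphFlag_singleton x n)))
  · rw [ofGraphChr_graphChr]
    exact (hub_chr ⟨x, rfl⟩).trans (congrArg (toPar (σ := Ty.one)) (point_singleton x))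

/-! ### Lower bounds -/

/-- The elements of `X`, with an additional first term less than `n`. -/
def copies (X : Set (ℕ → ℕ)) (n : ℕ) : Set (ℕ → ℕ) := {y | tail y ∈ X ∧ y 0 < n}

theorem isRec_copies :
    IsRec (τ := Ty.two ⇒ Ty.nat ⇒ Ty.two) fun G n => chr (copies (ones G) n) := by
  refine Rec.lam (Rec.lam (RecFunc.lam (RecPred.and ?_ (RecPred.lt ?_ Rec.var.weaken))))
  · exact RecPred.mem_ones Rec.var.weaken.weaken (RecSeq.tail Rec.var)
  · exact RecSeq.app Rec.var .zero

theorem copies_empty (n : ℕ) : copies ∅ n = ∅ := Set.eq_empty_of_forall_notMem fun _ h => h.1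

theorem encard_copies_singleton (x : ℕ → ℕ) (n : ℕ) : (copies {x} n).encard = n := by
  have himage : copies {x} n = (fun a => cons a x) '' {a | a < n} := by
    ext y
    constructor
    · rintro ⟨htail, hlt⟩
      exact ⟨y 0, hlt, (eq_cons_iff.2 ⟨rfl, htail⟩).symm⟩
    · rintro ⟨a, ha, rfl⟩
      exact ⟨rfl, ha⟩
  have hinj : Function.Injective fun a => cons a x := fun _ _ h => congrFun h 0
  rw [himage, hinj.encard_image, Set.Nat.encard_range]

theorem finite_copies {X : Set (ℕ → ℕ)} (hX : X.encard ≤ 1) (n : ℕ) : (copies X n).Finite := by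
  rcases Set.encard_le_one_iff_eq.1 hX with rfl | ⟨x, rfl⟩
  · rw [copies_empty]
    exact Set.finite_empty
  · exact Set.finite_of_encard_eq_coe (encard_copies_singleton x n)

section DomCode

variable {D : Dom} (c : DomCode D)

theorem DomCode.exists_entry_iff {Z : Set (ℕ → ℕ)} {s : ℕ → ℕ} (h : D.Lists (c.emb '' Z) s)
    (q : (ℕ → ℕ) → Prop) :
    (∃ i, i < s 0 ∧ entry s i ∈ ones (c.push (chr Z)) ∧ q (c.dec (entry s i))) ↔
      ∃ y ∈ Z, q y := by
  obtain ⟨l, ⟨hlen, hnames⟩, hsub⟩ := h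
  constructor
  · rintro ⟨i, -, hmem, hq⟩
    exact ⟨_, ind_eq_one.1 (ind_eq_one.1 hmem).2, hq⟩
  · rintro ⟨y, hy, hq⟩
    obtain ⟨i, hi, hyi⟩ := List.mem_iff_getElem.1 (hsub _ ⟨y, hy, rfl⟩)
    have hname : D.Names (entry s i) (c.emb y) := hyi ▸ hnames i hi
    refine ⟨i, hlen ▸ hi, ((c.repSet_push Z).apply_eq_one_iff hname).2 ⟨y, hy, rfl⟩, ?_⟩
    rwa [c.dec_eq hname]

theorem DomCode.isRec_exists_entry {F : Tot Ty.two → Tot Ty.two} {q : (ℕ → ℕ) → Prop}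
    (hF : IsRec (τ := Ty.two ⇒ Ty.two) F) (hq : IsRec (τ := Ty.two) fun y => ind (q y)) :
    IsRec (τ := Ty.two ⇒ Ty.one ⇒ Ty.nat) fun G (s : ℕ → ℕ) =>
      ind (∃ i, i < s 0 ∧ entry s i ∈ ones (F G) ∧ q (c.dec (entry s i))) := by
  refine Rec.lam (RecFunc.lam (RecPred.ex (RecPred.and ?_ (RecPred.and ?_ ?_))))
  · exact RecPred.lt Rec.var (RecSeq.app Rec.var.weaken .zero)
  · exact RecPred.mem_ones (Rec.app hF.rec Rec.var.weaken.weaken)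
      (RecSeq.entry Rec.var.weaken Rec.var)
  · exact RecFunc.app hq.rec (RecSeq.map c.dec_rec (RecSeq.entry Rec.var.weaken Rec.var))

theorem DomCode.isRec_push_copies (n : ℕ) :
    IsRec (τ := Ty.two ⇒ Ty.two) fun G => c.push (chr (copies (ones G) n)) :=
  Rec.lam (RecFunc.map c.isRec_push (Rec.app (Rec.app isRec_copies.rec Rec.var) (RecNat.const n)))

theorem DomCode.injOn_coord {Z : Set (ℕ → ℕ)} {i : ℕ} (h : Set.InjOn (fun y => y i) Z) :
    Set.InjOn (fun p => c.dec (c.cname p) i) (c.emb '' Z) := by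
  rintro _ ⟨y, hy, rfl⟩ _ ⟨y', hy', rfl⟩ heq
  simp only [c.dec_cname_emb] at heq
  exact congrArg c.emb (h hy hy' heq)

theorem DomCode.surjOn_coord {Z : Set (ℕ → ℕ)} {i : ℕ} (h : Set.SurjOn (fun y => y i) Z Set.univ) :
    Set.SurjOn (fun p => c.dec (c.cname p) i) (c.emb '' Z) Set.univ := by
  intro n hn
  obtain ⟨y, hy, rfl⟩ := h hn
  exact ⟨_, ⟨y, hy, rfl⟩, congrArg (fun x => x i) (c.dec_cname_emb y)⟩

end DomCode

variable {D : Dom}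

theorem bitHub_le_of_mem_omegaOne {Φ : Par (Ty.two ⇒ Ty.one)} (hΦ : Φ ∈ OmegaOne D) :
    ComputableModE2 bitHub Φ := by
  let c := domCode D
  have hpost : IsRec (τ := Ty.two ⇒ Ty.one ⇒ Ty.nat) fun _ y => ind (c.dec y 0 = 0) :=
    Rec.lam (RecFunc.lam (RecPred.eq_zero (RecSeq.app (RecSeq.map c.dec_rec Rec.var) .zero)))
  refine computable_of_query c.isRec_push hpost fun G hG => ?_
  obtain ⟨_, ⟨x, rfl⟩, rfl⟩ := exists_of_hub_ne_bot hG
  obtain ⟨y, hy, p, hp, hname⟩ := (hΦ (c.push (chr {x}))).1 (c.emb '' {x}) (c.repSet_push _)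
    ⟨c.emb x, Set.image_singleton⟩
  obtain rfl : c.emb x = p := by
    rw [Set.image_singleton] at hp
    exact Set.singleton_injective hp
  refine ⟨y, hy, (hub_chr ⟨x, rfl⟩).trans (congrArg (toPar (σ := Ty.nat)) (ind_congr ?_))⟩
  rw [c.dec_eq hname]
  exact exists_eq_left

theorem bitHub_le_of_mem_omegaEq {n : ℕ} (hn : 1 ≤ n) {Φ : Par (Ty.two ⇒ Ty.one)}
    (hΦ : Φ ∈ OmegaEq n) : ComputableModE2 bitHub Φ := by
  let c := unitCode
  have hq : IsRec (τ := Ty.two) fun (y : ℕ → ℕ) => ind (y 1 = 0) :=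
    RecFunc.lam (RecPred.eq_zero (RecSeq.app Rec.var (.const 1)))
  refine computable_of_query (c.isRec_push_copies n)
    (c.isRec_exists_entry (c.isRec_push_copies n) hq) fun G hG => ?_
  obtain ⟨_, ⟨x, rfl⟩, rfl⟩ := exists_of_hub_ne_bot hG
  rw [ones_chr]
  obtain ⟨s, hs, hlists⟩ := (hΦ (c.push (chr (copies {x} n)))).1 _ (c.repSet_push _)
    ((c.emb_injective.encard_image _).trans (encard_copies_singleton x n))
  refine ⟨s, hs, (hub_chr ⟨x, rfl⟩).trans (congrArg (toPar (σ := Ty.nat)) (ind_congr ?_))⟩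
  rw [c.exists_entry_iff hlists (q := fun y => y 1 = 0)]
  constructor
  · rintro ⟨_, rfl, h⟩
    exact ⟨cons 0 _, ⟨rfl, hn⟩, h⟩
  · rintro ⟨y, ⟨rfl, -⟩, h⟩
    exact ⟨_, rfl, h⟩

theorem nonemptyHub_le_of_mem_lists {dom : Set D.Pt → Prop} (hdom : ∀ X, X.encard ≤ 1 → dom X)
    {Φ : Par (Ty.two ⇒ Ty.one)} (hΦ : Φ ∈ D.SetFunctional Ty.one dom D.Lists) :
    ComputableModE2 nonemptyHub Φ := by
  let c := domCode D
  have htrue : IsRec (τ := Ty.two) fun _ => ind True :=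
    RecFunc.lam ((RecPred.eq .zero .zero).of_iff fun _ => iff_true_intro rfl)
  refine computable_of_query c.isRec_push (c.isRec_exists_entry c.isRec_push htrue) fun G hG => ?_
  obtain ⟨X, hX, rfl⟩ := exists_of_hub_ne_bot hG
  obtain ⟨s, hs, hlists⟩ := (hΦ (c.push (chr X))).1 _ (c.repSet_push X)
    (hdom _ ((c.emb_injective.encard_image X).trans_le hX))
  refine ⟨s, hs, (hub_chr hX).trans (congrArg (toPar (σ := Ty.nat)) (ind_congr ?_))⟩
  refine Iff.trans ?_ (c.exists_entry_iff hlists fun _ => True).symm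
  exact exists_congr fun _ => (and_iff_left trivial).symm

/-- The bounds on the cardinalities of all sets `copies X n` determine whether `X` is nonempty: for
`X = ∅` they are all equal, and otherwise the bound for `n = y 0 + 1` exceeds `y 0`. -/
theorem nonemptyHub_le_of_mem_omegaCardBound {Φ : Par (Ty.two ⇒ Ty.nat)}
    (hΦ : Φ ∈ OmegaCardBound) : ComputableModE2 nonemptyHub Φ := by
  let c := unitCode
  have hprep : IsRec (τ := Ty.two ⇒ Ty.nat ⇒ Ty.two) fun G n => c.push (chr (copies (ones G) n)) :=
    Rec.lam (Rec.lam (RecFunc.map c.isRec_push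
      (Rec.app (Rec.app isRec_copies.rec Rec.var.weaken) Rec.var)))
  have hpost : IsRec (τ := Ty.two ⇒ Ty.one ⇒ Ty.nat) fun _ (y : ℕ → ℕ) =>
      ind (¬ y (y 0 + 1) = y 0) :=
    Rec.lam (RecFunc.lam (RecPred.not (RecPred.eq
      (RecSeq.app Rec.var (RecNat.succ (RecSeq.app Rec.var .zero))) (RecSeq.app Rec.var .zero))))
  refine computable_of_queries (α := Ty.nat) hprep hpost fun G hG => ?_
  obtain ⟨X, hX, rfl⟩ := exists_of_hub_ne_bot hG
  have hbound (n : ℕ) : ∃ m : ℕ, Φ (c.push (chr (copies X n))) = toPar (σ := Ty.nat) m ∧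
      (c.emb '' copies X n).encard ≤ m :=
    (hΦ _).1 _ (c.repSet_push _) ((finite_copies hX n).image _)
  choose y hy hle using hbound
  refine ⟨y, fun n => by rw [ones_chr]; exact hy n,
    (hub_chr hX).trans (congrArg (toPar (σ := Ty.nat)) (ind_congr ?_))⟩
  rcases Set.encard_le_one_iff_eq.1 hX with rfl | ⟨x, rfl⟩
  · refine iff_of_false Set.not_nonempty_empty (not_not.2 (toPar_injective (σ := Ty.nat) ?_))
    rw [← hy, ← hy, copies_empty, copies_empty]
  · refine iff_of_true (Set.singleton_nonempty x) fun heq => ?_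
    have hsucc := hle (y 0 + 1)
    rw [c.emb_injective.encard_image, encard_copies_singleton, heq] at hsucc
    exact absurd (Nat.cast_le.1 hsucc) (Nat.not_succ_le_self _)

theorem Dom.Enumerates.zero_eq {A : Set D.Pt} {e : ℕ → ℕ → ℕ} (h : D.Enumerates A e) :
    e 0 0 = ind A.Nonempty := by
  rcases h with ⟨x, rfl, hx⟩ | ⟨rfl, hx⟩
  · rw [ind_true (Set.range_nonempty x)]
    exact (hx 0).1
  · rw [ind_false Set.not_nonempty_empty]
    exact (hx 0).1

theorem Dom.Enumerates.exists_names_entry {A : Set D.Pt} {e : ℕ → ℕ → ℕ} (h : D.Enumerates A e)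
    (hA : A.Nonempty) : ∃ p ∈ A, D.Names (entry (e 0) 0) p := by
  rcases h with ⟨x, rfl, hx⟩ | ⟨rfl, -⟩
  · exact ⟨x 0, Set.mem_range_self 0, (hx 0).2 0 Nat.one_pos⟩
  · exact absurd hA Set.not_nonempty_empty

/-- The set of all sequences with a given tail is mapped onto `ℕ` by the first coordinate. -/
theorem bitHub_le_of_mem_weakEnumeration {Φ : Par (Ty.two ⇒ Ty.two ⇒ Ty.nat ⇒ Ty.one)}
    (hΦ : Φ ∈ WeakEnumerationFunctional) : ComputableModE2 bitHub Φ := by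
  let c := unitCode
  have hprep : IsRec (τ := Ty.two ⇒ Ty.two) fun G => c.push (chr (tail ⁻¹' ones G)) :=
    Rec.lam (RecFunc.map c.isRec_push (RecFunc.lam (RecPred.mem_ones
      (x := fun j : Tot Ty.one × _ => tail j.1) Rec.var.weaken (RecSeq.tail Rec.var))))
  have hpost : IsRec (τ := (Ty.nat ⇒ Ty.one) ⇒ Ty.nat) fun (e : ℕ → ℕ → ℕ) =>
      ind (c.dec (entry (e 0) 0) 1 = 0) :=
    Rec.lam (RecPred.eq_zero (RecSeq.app (RecSeq.map c.dec_rec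
      (RecSeq.entry (Rec.app (σ := Ty.nat) (τ := Ty.one) Rec.var RecNat.zero) .zero)) (.const 1)))
  refine computable_of_query₂ hprep (c.isRec_coord 0) hpost fun G hG => ?_
  obtain ⟨_, ⟨x, rfl⟩, rfl⟩ := exists_of_hub_ne_bot hG
  rw [ones_chr]
  have hinj : Set.InjOn (fun y => y 0) (tail ⁻¹' {x}) :=
    fun y hy y' hy' h => eq_of_tail_eq h (Eq.trans hy (Eq.symm hy'))
  have hsurj : Set.SurjOn (fun y => y 0) (tail ⁻¹' {x}) Set.univ := fun n _ => ⟨cons n x, rfl, rfl⟩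
  obtain ⟨e, he, henum⟩ := (hΦ _ _).1 _ _ (c.repSet_push _) (c.repFun_coord 0)
    ⟨c.injOn_coord hinj, c.surjOn_coord hsurj⟩
  refine ⟨e, he, (hub_chr ⟨x, rfl⟩).trans (congrArg (toPar (σ := Ty.nat)) (ind_congr ?_))⟩
  obtain ⟨_, ⟨y, rfl, rfl⟩, hname⟩ :=
    henum.exists_names_entry (Set.Nonempty.image _ ⟨cons 0 x, rfl⟩)
  rw [c.dec_eq hname]
  exact exists_eq_left

theorem nonemptyHub_le_of_mem_enumeration {Φ : Par (Ty.two ⇒ Ty.two ⇒ Ty.nat ⇒ Ty.one)}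
    (hΦ : Φ ∈ EnumerationFunctional) : ComputableModE2 nonemptyHub Φ := by
  let c := unitCode
  have hpost : IsRec (τ := (Ty.nat ⇒ Ty.one) ⇒ Ty.nat) fun (e : ℕ → ℕ → ℕ) => e 0 0 :=
    Rec.lam (RecSeq.app (Rec.app (σ := Ty.nat) (τ := Ty.one) Rec.var RecNat.zero) .zero)
  refine computable_of_query₂ c.isRec_push (c.isRec_coord 0) hpost fun G hG => ?_
  obtain ⟨X, hX, rfl⟩ := exists_of_hub_ne_bot hG
  have hinj : Set.InjOn (fun y => y 0) X :=
    fun y hy y' hy' _ => Set.encard_le_one_iff.1 hX y y' hy hy'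
  obtain ⟨e, he, henum⟩ := (hΦ _ _).1 _ _ (c.repSet_push X) (c.repFun_coord 0) (c.injOn_coord hinj)
  refine ⟨e, he, (hub_chr hX).trans (congrArg (toPar (σ := Ty.nat)) ?_)⟩
  rw [henum.zero_eq, Set.image_nonempty]

theorem graphDigits_one (y : ℕ → ℕ) : graphDigits y 1 = ind (y 0 = 0) := by
  rw [graphDigits_succ, graphChr, Nat.unpair_zero]
  exact Nat.zero_add _

theorem one_third_le_embReal {y : ℕ → ℕ} (hy : y 0 = 0) : 1 / 3 ≤ embReal y := by
  have hlb := (embReal_bounds y 1).1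
  rw [graphDigits_one, ind_true hy] at hlb
  norm_num at hlb
  linarith

theorem embReal_le_two_ninths {y : ℕ → ℕ} (hy : y 0 ≠ 0) : embReal y ≤ 2 / 9 := by
  have hub := (embReal_bounds y 1).2
  rw [graphDigits_one, ind_false hy] at hub
  norm_num at hub
  linarith

theorem ternaryFloor_one_ne_zero_iff {z : ℕ → ℕ} {r : ℝ} (h : CodesReal z r) (hr : 0 ≤ r) :
    ¬ ternaryFloor z 1 = 0 ↔ 1 / 3 ≤ r := by
  rw [ternaryFloor_eq h hr, Nat.floor_eq_zero, not_lt, pow_one, div_le_iff₀' three_pos]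

theorem NamesSup.ternaryFloor_ne_zero_iff {Z : Set (ℕ → ℕ)} {z : ℕ → ℕ}
    (h : NamesSup (unitCode.emb '' Z) z) : ¬ ternaryFloor z 1 = 0 ↔ ∃ y ∈ Z, y 0 = 0 := by
  obtain ⟨p, hp, hz⟩ := h
  rw [ternaryFloor_one_ne_zero_iff hz p.2.1]
  constructor
  · intro hge
    by_contra! hne
    have hle : p ≤ (⟨2 / 9, by norm_num, by norm_num⟩ : unitInterval) := hp.2 (by
      rintro _ ⟨y, hy, rfl⟩
      exact embReal_le_two_ninths (hne y hy))
    have := hge.trans (Subtype.coe_le_coe.2 hle)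
    norm_num at this
  · rintro ⟨y, hy, hzero⟩
    exact (one_third_le_embReal hzero).trans (hp.1 ⟨y, hy, rfl⟩)

theorem isRec_ternaryFloor_one_ne_zero :
    IsRec (τ := Ty.one ⇒ Ty.nat) fun z => ind (¬ ternaryFloor z 1 = 0) :=
  RecFunc.lam (RecPred.not (RecPred.eq_zero (RecNat.ternaryFloor Rec.var (.const 1))))

/-- The sequences `y` such that `y` without its first two values belongs to `X`, and starts with
`y 0`. For a singleton `X`, all of them have the same first value, and they are enumerated by their
second value. -/
def prefixed (X : Set (ℕ → ℕ)) : Set (ℕ → ℕ) := {y | tail (tail y) ∈ X ∧ y 0 = y 2}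

theorem isRec_prefixed : IsRec (τ := Ty.two ⇒ Ty.two) fun G => chr (prefixed (ones G)) := by
  refine Rec.lam (RecFunc.lam (RecPred.and ?_ (RecPred.eq ?_ ?_)))
  · exact RecPred.mem_ones Rec.var.weaken (RecSeq.tail (RecSeq.tail Rec.var))
  · exact RecSeq.app Rec.var .zero
  · exact RecSeq.app Rec.var (.const 2)

theorem apply_zero_of_mem_prefixed {x y : ℕ → ℕ} (hy : y ∈ prefixed {x}) : y 0 = x 0 :=
  hy.2.trans (congrFun hy.1 0)

theorem injOn_prefixed (x : ℕ → ℕ) : Set.InjOn (fun y => y 1) (prefixed {x}) := by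
  intro y hy y' hy' h
  refine eq_of_tail_eq ?_ (eq_of_tail_eq h (Eq.trans hy.1 (Eq.symm hy'.1)))
  rw [apply_zero_of_mem_prefixed hy, apply_zero_of_mem_prefixed hy']

theorem cons_mem_prefixed (x : ℕ → ℕ) (n : ℕ) : cons (x 0) (cons n x) ∈ prefixed {x} := ⟨rfl, rfl⟩

theorem bitHub_le_of_mem_weakOmegaBW {Φ : Par (Ty.two ⇒ Ty.two ⇒ Ty.one)}
    (hΦ : Φ ∈ WeakOmegaBW) : ComputableModE2 bitHub Φ := by
  let c := unitCode
  have hprep : IsRec (τ := Ty.two ⇒ Ty.two) fun G => c.push (chr (prefixed (ones G))) :=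
    Rec.lam (RecFunc.map c.isRec_push (Rec.app isRec_prefixed.rec Rec.var))
  refine computable_of_query₂ hprep (c.isRec_coord 1) isRec_ternaryFloor_one_ne_zero fun G hG => ?_
  obtain ⟨_, ⟨x, rfl⟩, rfl⟩ := exists_of_hub_ne_bot hG
  rw [ones_chr]
  obtain ⟨z, hz, hsup⟩ := (hΦ _ _).1 _ _ (c.repSet_push _) (c.repFun_coord 1)
    ⟨c.injOn_coord (injOn_prefixed x), c.surjOn_coord fun n _ => ⟨_, cons_mem_prefixed x n, rfl⟩⟩
  refine ⟨z, hz, (hub_chr ⟨x, rfl⟩).trans (congrArg (toPar (σ := Ty.nat)) (ind_congr ?_))⟩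
  rw [hsup.ternaryFloor_ne_zero_iff]
  constructor
  · rintro ⟨_, rfl, h⟩
    exact ⟨_, cons_mem_prefixed _ 0, h⟩
  · rintro ⟨y, hy, h⟩
    exact ⟨x, rfl, (apply_zero_of_mem_prefixed hy).symm.trans h⟩

theorem nonemptyHub_le_of_mem_omegaBW {Φ : Par (Ty.two ⇒ Ty.two ⇒ Ty.one)}
    (hΦ : Φ ∈ OmegaBW) : ComputableModE2 nonemptyHub Φ := by
  let c := unitCode
  refine computable_of_query₂ (c.isRec_push_copies 1) (c.isRec_coord 1)
    isRec_ternaryFloor_one_ne_zero fun G hG => ?_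
  obtain ⟨X, hX, rfl⟩ := exists_of_hub_ne_bot hG
  rw [ones_chr]
  have hzero {y : ℕ → ℕ} (hy : y ∈ copies X 1) : y 0 = 0 := Nat.lt_one_iff.1 hy.2
  have hinj : Set.InjOn (fun y => y 1) (copies X 1) := fun y hy y' hy' _ =>
    eq_of_tail_eq ((hzero hy).trans (hzero hy').symm) (Set.encard_le_one_iff.1 hX _ _ hy.1 hy'.1)
  obtain ⟨z, hz, hsup⟩ := (hΦ _ _).1 _ _ (c.repSet_push _) (c.repFun_coord 1) (c.injOn_coord hinj)
  refine ⟨z, hz, (hub_chr hX).trans (congrArg (toPar (σ := Ty.nat)) (ind_congr ?_))⟩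
  rw [hsup.ternaryFloor_ne_zero_iff]
  constructor
  · rintro ⟨x, hx⟩
    exact ⟨cons 0 x, ⟨hx, Nat.one_pos⟩, rfl⟩
  · rintro ⟨y, hy, -⟩
    exact ⟨_, hy.1⟩

/-! ### Upper bounds -/

namespace DomCode

variable {D : Dom} (c : DomCode D)

section SetFunctional

variable {τ : Ty} {dom : Set D.Pt → Prop} {v : Set (ℕ → ℕ) → Tot τ}

open Classical in
/-- The functional with domain `dom` whose value is computed by `v` from the set of canonical
names of the elements of the input. -/
noncomputable def setFunctional (dom : Set D.Pt → Prop) (v : Set (ℕ → ℕ) → Tot τ) :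
    Par (Ty.two ⇒ τ) := fun G =>
  if ∃ X, D.RepSet G X ∧ dom X then toPar (v (ones (c.canon G))) else ⊥

theorem setFunctional_eq {G : Tot Ty.two} {X : Set D.Pt} (h : D.RepSet G X) (hX : dom X) :
    c.setFunctional dom v G = toPar (v (c.cname '' X)) := by
  rw [← ones_chr (c.cname '' X), ← c.canon_eq h]
  exact if_pos ⟨X, h, hX⟩

theorem setFunctional_mem {out : Set D.Pt → Tot τ → Prop}
    (h : ∀ X, dom X → out X (v (c.cname '' X))) :
    c.setFunctional dom v ∈ D.SetFunctional τ dom out := fun _ =>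
  ⟨fun X hG hX => ⟨_, c.setFunctional_eq hG hX, h X hX⟩,
    fun hn => if_neg fun ⟨X, hG, hX⟩ => hn X hG hX⟩

theorem setFunctional_le_hub {α : Ty} {dom' : Set (ℕ → ℕ) → Prop} {val : Set (ℕ → ℕ) → Tot α}
    {post : Tot (α ⇒ τ)} (hpost : IsRec post) (hdom : ∀ X, dom X → dom' (c.cname '' X))
    (hv : ∀ X, v X = post (val X)) (hα : (Ty.two ⇒ α ⇒ τ).rank ≤ 3 := by decide)
    (hτ : (Ty.two ⇒ τ).rank ≤ 3 := by decide) :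
    ComputableModE2 (c.setFunctional dom v) (hub dom' val) := by
  refine computable_of_query (post := fun _ => post) c.isRec_canon (Rec.lam hpost.rec hα)
    (fun G hG => ?_) hτ
  obtain ⟨X, hX, hdomX⟩ : ∃ X, D.RepSet G X ∧ dom X := not_not.1 fun hn => hG (if_neg hn)
  refine ⟨val (c.cname '' X), ?_, ?_⟩
  · rw [c.canon_eq hX]
    exact hub_chr (hdom X hdomX)
  · rw [c.setFunctional_eq hX hdomX, hv]

end SetFunctional

/-- The set of canonical names of the elements of `A` at which `Y` has the value `n`. -/
def fiberNames (A : Set D.Pt) (Y : D.Pt → ℕ) (n : ℕ) : Set (ℕ → ℕ) := c.cname '' (A ∩ Y ⁻¹' {n})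

theorem sep_ones_canon_eq {G H : Tot Ty.two} {A : Set D.Pt} {Y : D.Pt → ℕ} (hG : D.RepSet G A)
    (hH : D.RepFun H Y) (n : ℕ) : {x ∈ ones (c.canon G) | H x = n} = c.fiberNames A Y n := by
  ext x
  rw [c.canon_eq hG, ones_chr]
  constructor
  · rintro ⟨⟨p, hp, rfl⟩, hn⟩
    exact ⟨p, ⟨hp, (hH _ p (c.names_cname p)).symm.trans hn⟩, rfl⟩
  · rintro ⟨p, ⟨hp, hn⟩, rfl⟩
    exact ⟨⟨p, hp, rfl⟩, (hH _ p (c.names_cname p)).trans hn⟩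

theorem isRec_sep_ones_canon : IsRec (τ := Ty.two ⇒ Ty.two ⇒ Ty.nat ⇒ Ty.two)
    fun G H n => chr {x ∈ ones (c.canon G) | H x = n} := by
  refine Rec.lam (Rec.lam (Rec.lam (RecFunc.lam (RecPred.and ?_ (RecPred.eq ?_ ?_)))))
  · exact RecPred.mem_ones (RecFunc.map c.isRec_canon Rec.var.weaken.weaken.weaken) Rec.var
  · exact RecFunc.app Rec.var.weaken.weaken Rec.var
  · exact Rec.var.weaken

section SetFunFunctional

variable {τ : Ty} {dom : Set D.Pt → (D.Pt → ℕ) → Prop} {v : (ℕ → Set (ℕ → ℕ)) → Tot τ}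

open Classical in
/-- The functional with domain `dom` whose value is computed by `v` from the sets of canonical
names of the elements of `A` with a given value of `Y`. -/
noncomputable def setFunFunctional (dom : Set D.Pt → (D.Pt → ℕ) → Prop)
    (v : (ℕ → Set (ℕ → ℕ)) → Tot τ) : Par (Ty.two ⇒ Ty.two ⇒ τ) := fun G H =>
  if ∃ A Y, D.RepSet G A ∧ D.RepFun H Y ∧ dom A Y then
    toPar (v fun n => {x ∈ ones (c.canon G) | H x = n}) else ⊥

theorem setFunFunctional_eq {G H : Tot Ty.two} {A : Set D.Pt} {Y : D.Pt → ℕ}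
    (hG : D.RepSet G A) (hH : D.RepFun H Y) (hA : dom A Y) :
    c.setFunFunctional dom v G H = toPar (v (c.fiberNames A Y)) := by
  rw [← funext (c.sep_ones_canon_eq hG hH)]
  exact if_pos ⟨A, Y, hG, hH, hA⟩

theorem setFunFunctional_mem {out : Set D.Pt → Tot τ → Prop}
    (h : ∀ A Y, dom A Y → out A (v (c.fiberNames A Y))) :
    c.setFunFunctional dom v ∈ D.SetFunFunctional τ dom out := fun _ _ =>
  ⟨fun A Y hG hH hA => ⟨_, c.setFunFunctional_eq hG hH hA, h A Y hA⟩,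
    fun hn => if_neg fun ⟨A, Y, hG, hH, hA⟩ => hn A Y hG hH hA⟩

theorem setFunFunctional_le_hub {dom' : Set (ℕ → ℕ) → Prop} {val : Set (ℕ → ℕ) → Tot Ty.one}
    {post : Tot ((Ty.nat ⇒ Ty.one) ⇒ τ)} (hpost : IsRec post)
    (hdom : ∀ A Y, dom A Y → ∀ n, dom' (c.fiberNames A Y n))
    (hv : ∀ F : ℕ → Set (ℕ → ℕ), (∀ n, dom' (F n)) → v F = post fun n => val (F n))
    (hpost' : (Ty.two ⇒ (Ty.nat ⇒ Ty.one) ⇒ τ).rank ≤ 3 := by decide)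
    (hpost'' : (Ty.two ⇒ Ty.two ⇒ (Ty.nat ⇒ Ty.one) ⇒ τ).rank ≤ 3 := by decide)
    (hτ : (Ty.two ⇒ Ty.two ⇒ τ).rank ≤ 3 := by decide) :
    ComputableModE2 (c.setFunFunctional dom v) (hub dom' val) := by
  refine computable_of_queries₂ (α := Ty.one) (post := fun _ _ => post) c.isRec_sep_ones_canon
    (Rec.lam (Rec.lam hpost.rec hpost') hpost'') (fun G H hGH => ?_) (by decide) hτ
  obtain ⟨A, Y, hG, hH, hA⟩ : ∃ A Y, D.RepSet G A ∧ D.RepFun H Y ∧ dom A Y :=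
    not_not.1 fun hn => hGH (if_neg hn)
  refine ⟨fun n => val (c.fiberNames A Y n), fun n => ?_, ?_⟩
  · exact (congrArg (fun X => hub dom' val (chr X)) (c.sep_ones_canon_eq hG hH n)).trans
      (hub_chr (hdom A Y hA n))
  · rw [c.setFunFunctional_eq hG hH hA, hv _ (hdom A Y hA)]

end SetFunFunctional

theorem lists_sortCode {X : Set D.Pt} (hX : X.Finite) :
    D.Lists X (sortCode (c.cname '' X)) := by
  have hentries : entries (sortCode (c.cname '' X)) = c.cname '' X :=
    entries_sortCode (hX.image c.cname)
  have hpoint (i : Fin (sortCode (c.cname '' X) 0)) :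
      ∃ p, c.cname p = entry (sortCode (c.cname '' X)) i := by
    obtain ⟨p, -, hp⟩ := hentries.subset ⟨i, rfl⟩
    exact ⟨p, hp⟩
  choose p hp using hpoint
  refine ⟨List.ofFn p, ⟨List.length_ofFn.symm, fun i hi => ?_⟩, fun q hq => ?_⟩
  · rw [List.length_ofFn] at hi
    rw [List.getElem_ofFn, ← show _ = entry (sortCode (c.cname '' X)) i from hp ⟨i, hi⟩]
    exact c.names_cname _
  · obtain ⟨i, hi⟩ := hentries.superset ⟨q, hq, rfl⟩
    exact List.mem_ofFn.2 ⟨i, c.cname_injective ((hp i).trans hi)⟩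

theorem namesList_single (p : D.Pt) : D.NamesList (single (c.cname p)) [p] := by
  refine ⟨rfl, fun i hi => ?_⟩
  obtain rfl : i = 0 := Nat.lt_one_iff.1 hi
  rw [entry_single]
  exact c.names_cname p

section InjOn

variable {A : Set D.Pt} {Y : D.Pt → ℕ}

theorem fiberNames_apply (hY : Set.InjOn Y A) {p : D.Pt} (hp : p ∈ A) :
    c.fiberNames A Y (Y p) = {c.cname p} := by
  have hfiber : A ∩ Y ⁻¹' {Y p} = {p} :=
    Set.eq_singleton_iff_unique_mem.2 ⟨⟨hp, rfl⟩, fun q hq => hY hq.1 hp hq.2⟩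
  rw [fiberNames, hfiber, Set.image_singleton]

theorem finite_fiberNames (hY : Set.InjOn Y A) (n : ℕ) : (c.fiberNames A Y n).Finite := by
  refine Set.Finite.image _ (Set.Subsingleton.finite fun p hp q hq => hY hp.1 hq.1 ?_)
  exact hp.2.trans hq.2.symm

theorem fiberNames_eq_singleton (hY : Set.InjOn Y A) (hY' : Set.SurjOn Y A Set.univ) (n : ℕ) :
    ∃ x, c.fiberNames A Y n = {x} := by
  obtain ⟨p, hp, rfl⟩ := hY' (Set.mem_univ n)
  exact ⟨_, c.fiberNames_apply hY hp⟩

/-- The sequence of the sorted codes of the sets of canonical names of the elements of `A` with a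
given value of `Y`. -/
noncomputable def fiberCode (A : Set D.Pt) (Y : D.Pt → ℕ) (n : ℕ) : ℕ → ℕ :=
  sortCode (c.fiberNames A Y n)

theorem fiberCode_apply (hY : Set.InjOn Y A) {p : D.Pt} (hp : p ∈ A) :
    c.fiberCode A Y (Y p) = single (c.cname p) := by
  rw [fiberCode, c.fiberNames_apply hY hp, sortCode_singleton]

theorem fiberCode_ne_zero_iff (hY : Set.InjOn Y A) {n : ℕ} :
    c.fiberCode A Y n 0 ≠ 0 ↔ ∃ p ∈ A, Y p = n := by
  rw [fiberCode, Ne, sortCode_zero_eq_zero (c.finite_fiberNames hY n), fiberNames,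
    Set.image_eq_empty, ← Ne, ← Set.nonempty_iff_ne_empty]
  rfl

end InjOn

end DomCode

theorem hub_encard_eq_le (n : ℕ) :
    ComputableModE2 (hub (τ := Ty.one) (fun X => X.encard = n) sortCode) singletonHub := by
  have hprep : IsRec (τ := Ty.two ⇒ Ty.two) fun G =>
      chr {s | IsSorted s ∧ (∀ i < s 0, entry s i ∈ ones G) ∧ s 0 = n} := by
    refine Rec.lam (RecFunc.lam (RecPred.and ?_
      (RecPred.and (RecPred.all (RecPred.imp ?_ ?_)) (RecPred.eq ?_ (.const n)))))
    · exact RecFunc.app isRec_isSorted.rec Rec.var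
    · exact RecPred.lt Rec.var (RecSeq.app Rec.var.weaken .zero)
    · exact RecPred.mem_ones Rec.var.weaken.weaken (RecSeq.entry Rec.var.weaken Rec.var)
    · exact RecSeq.app Rec.var .zero
  refine computable_of_query (post := fun _ s => s) hprep (Rec.lam isRec_id.rec) fun G hG => ?_
  obtain ⟨X, hX, rfl⟩ := exists_of_hub_ne_bot hG
  refine ⟨sortCode X, ?_, hub_chr hX⟩
  have hset : {s | IsSorted s ∧ (∀ i < s 0, entry s i ∈ X) ∧ s 0 = n} = {sortCode X} := by
    ext s
    rw [Set.mem_singleton_iff, eq_sortCode_iff (Set.finite_of_encard_eq_coe hX), hX, Nat.cast_inj,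
      eq_comm (a := n)]
    rfl
  rw [ones_chr, hset]
  exact (hub_chr ⟨_, rfl⟩).trans (congrArg (toPar (σ := Ty.one)) (point_singleton _))

/-- The enumeration of a set that is obtained from a sequence of codes of sets with at most one
element; it is padded with the first element that occurs. -/
noncomputable def enumOf (e : ℕ → ℕ → ℕ) (n k : ℕ) : ℕ :=
  if e n 0 = 0 then e (sInf {m | e m 0 ≠ 0}) k else e n k

theorem isRec_enumOf : IsRec (τ := (Ty.nat ⇒ Ty.one) ⇒ Ty.nat ⇒ Ty.one) enumOf := by
  refine Rec.lam (Rec.lam (RecSeq.lam (RecNat.cond ?_ ?_ ?_)))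
  · exact RecSeq.app (Rec.app (σ := Ty.nat) (τ := Ty.one) Rec.var.weaken.weaken Rec.var.weaken)
      .zero
  · refine RecSeq.app (Rec.app (σ := Ty.nat) (τ := Ty.one) Rec.var.weaken.weaken
      (RecNat.nat_sInf (RecPred.not (RecPred.eq ?_ .zero)))) Rec.var
    exact RecSeq.app (Rec.app (σ := Ty.nat) (τ := Ty.one) Rec.var.weaken.weaken.weaken Rec.var)
      .zero
  · exact RecSeq.app (Rec.app (σ := Ty.nat) (τ := Ty.one) Rec.var.weaken.weaken Rec.var.weaken)
      Rec.var

/-- The supremum of the real numbers whose names are listed in `e`, in ternary expansion. -/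
noncomputable def supOf (e : ℕ → ℕ → ℕ) (n : ℕ) : ℕ :=
  frac (sInf {k | ∀ i, e i 0 ≠ 0 → ternaryFloor (entry (e i) 0) n ≤ k}) (3 ^ n)

theorem isRec_supOf : IsRec (τ := (Ty.nat ⇒ Ty.one) ⇒ Ty.one) supOf := by
  refine Rec.lam (RecSeq.lam (RecNat.frac (RecNat.nat_sInf (RecPred.all (RecPred.imp
    (RecPred.not (RecPred.eq (RecSeq.app ?_ .zero) .zero)) (RecPred.le ?_ Rec.var.weaken))))
    (RecNat.pow (.const 3) Rec.var)))
  · exact Rec.app (σ := Ty.nat) (τ := Ty.one) Rec.var.weaken.weaken.weaken Rec.var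
  · exact RecNat.ternaryFloor (RecSeq.entry
      (Rec.app (σ := Ty.nat) (τ := Ty.one) Rec.var.weaken.weaken.weaken Rec.var) .zero)
      Rec.var.weaken.weaken

theorem isRec_comp_single {τ : Ty} {F : Tot ((Ty.nat ⇒ Ty.one) ⇒ τ)} (hF : IsRec F)
    (hτ : ((Ty.nat ⇒ Ty.one) ⇒ τ).rank ≤ 3 := by decide) :
    IsRec (τ := (Ty.nat ⇒ Ty.one) ⇒ τ) fun e => F fun n => single (e n) := by
  refine Rec.lam (Rec.app (σ := Ty.nat ⇒ Ty.one) hF.rec (Rec.lam (RecSeq.map isRec_single ?_))) hτ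
  exact Rec.app (σ := Ty.nat) (τ := Ty.one) Rec.var.weaken Rec.var

namespace DomCode

variable {D : Dom} (c : DomCode D) {A : Set D.Pt} {Y : D.Pt → ℕ}

theorem enumOf_fiberCode_empty (n : ℕ) : enumOf (c.fiberCode ∅ Y) n = fun _ => 0 := by
  have hzero (m : ℕ) : c.fiberCode ∅ Y m = fun _ => 0 := by
    rw [fiberCode, fiberNames, Set.empty_inter, Set.image_empty, sortCode_empty]
  funext k
  simp only [enumOf, hzero, ite_self]

theorem enumOf_fiberCode_apply (hY : Set.InjOn Y A) {p : D.Pt} (hp : p ∈ A) :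
    enumOf (c.fiberCode A Y) (Y p) = single (c.cname p) := by
  rw [← c.fiberCode_apply hY hp]
  exact funext fun k => if_neg ((c.fiberCode_ne_zero_iff hY).2 ⟨p, hp, rfl⟩)

theorem exists_enumOf_fiberCode_eq (hY : Set.InjOn Y A) (hA : A.Nonempty) (n : ℕ) :
    ∃ p ∈ A, enumOf (c.fiberCode A Y) n = single (c.cname p) := by
  by_cases hn : c.fiberCode A Y n 0 = 0
  · obtain ⟨p₀, hp₀⟩ := hA
    have hfirst : c.fiberCode A Y (sInf {m | c.fiberCode A Y m 0 ≠ 0}) 0 ≠ 0 :=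
      Nat.sInf_mem (s := {m | c.fiberCode A Y m 0 ≠ 0})
        ⟨Y p₀, (c.fiberCode_ne_zero_iff hY).2 ⟨p₀, hp₀, rfl⟩⟩
    obtain ⟨p, hp, hpY⟩ := (c.fiberCode_ne_zero_iff hY).1 hfirst
    refine ⟨p, hp, ?_⟩
    rw [← c.fiberCode_apply hY hp, hpY]
    exact funext fun k => if_pos hn
  · obtain ⟨p, hp, rfl⟩ := (c.fiberCode_ne_zero_iff hY).1 hn
    exact ⟨p, hp, c.enumOf_fiberCode_apply hY hp⟩

theorem enumerates_enumOf (hY : Set.InjOn Y A) : D.Enumerates A (enumOf (c.fiberCode A Y)) := by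
  rcases A.eq_empty_or_nonempty with rfl | hA
  · refine Or.inr ⟨rfl, fun n => ?_⟩
    rw [c.enumOf_fiberCode_empty]
    exact ⟨rfl, fun i hi => absurd hi (Nat.not_lt_zero i)⟩
  · choose x hxA hx using c.exists_enumOf_fiberCode_eq hY hA
    refine Or.inl ⟨x, Set.Subset.antisymm (Set.range_subset_iff.2 hxA) fun p hp => ⟨Y p, ?_⟩,
      fun n => ?_⟩
    · have hsingle : single (c.cname (x (Y p))) = single (c.cname p) :=
        (hx (Y p)).symm.trans (c.enumOf_fiberCode_apply hY hp)
      apply c.cname_injective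
      rw [← entry_single (c.cname p), ← hsingle, entry_single]
    · rw [hx n]
      exact c.namesList_single (x n)

end DomCode

/-- The least natural number `k` with `⌊3 ^ n * p⌋ ≤ k` for all `p ∈ A`: the first `n` ternary
digits of the supremum of `A`, possibly in an expansion that ends with twos. -/
noncomputable def ternarySup (A : Set unitInterval) (n : ℕ) : ℕ :=
  sInf {k | ∀ p ∈ A, ⌊(3 : ℝ) ^ n * p⌋₊ ≤ k}

section TernarySup

variable {A : Set unitInterval} {n : ℕ}

theorem ternarySup_le {k : ℕ} (h : ∀ p ∈ A, ⌊(3 : ℝ) ^ n * p⌋₊ ≤ k) : ternarySup A n ≤ k :=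
  Nat.sInf_le h

theorem floor_three_pow_mul_le (p : unitInterval) (n : ℕ) : ⌊(3 : ℝ) ^ n * p⌋₊ ≤ 3 ^ n := by
  refine Nat.floor_le_of_le ?_
  push_cast
  exact mul_le_of_le_one_right (by positivity) p.2.2

theorem floor_le_ternarySup {p : unitInterval} (hp : p ∈ A) :
    ⌊(3 : ℝ) ^ n * p⌋₊ ≤ ternarySup A n :=
  Nat.sInf_mem (s := {k | ∀ p ∈ A, ⌊(3 : ℝ) ^ n * p⌋₊ ≤ k})
    ⟨3 ^ n, fun p _ => floor_three_pow_mul_le p n⟩ p hp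

theorem floor_three_pow_succ_div (r : ℝ) (n : ℕ) :
    ⌊(3 : ℝ) ^ (n + 1) * r⌋₊ / 3 = ⌊(3 : ℝ) ^ n * r⌋₊ := by
  rw [← Nat.floor_div_ofNat, pow_succ]
  congr 1
  ring

theorem three_mul_ternarySup_le (A : Set unitInterval) (n : ℕ) :
    3 * ternarySup A n ≤ ternarySup A (n + 1) := by
  suffices h : ternarySup A n ≤ ternarySup A (n + 1) / 3 by omega
  refine ternarySup_le fun p hp => ?_
  rw [← floor_three_pow_succ_div]
  exact Nat.div_le_div_right (floor_le_ternarySup hp)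

theorem ternarySup_succ_le (A : Set unitInterval) (n : ℕ) :
    ternarySup A (n + 1) ≤ 3 * ternarySup A n + 2 := by
  refine ternarySup_le fun p hp => ?_
  have hdigit := floor_three_pow_succ_div p n
  have hfloor := floor_le_ternarySup (n := n) hp
  omega

theorem exists_isLUB_codesReal_ternarySup (A : Set unitInterval) :
    ∃ p : unitInterval, IsLUB A p ∧ CodesReal (fun n => frac (ternarySup A n) (3 ^ n)) p := by
  obtain ⟨r, hr, hbounds⟩ :=
    exists_codesReal_ternary (three_mul_ternarySup_le A) (ternarySup_succ_le A)
  have hupper : ∀ p ∈ A, (p : ℝ) ≤ r := fun p hp => le_of_forall_three_pow fun n => by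
    have hp_lt := Nat.lt_floor_add_one ((3 : ℝ) ^ n * p)
    have hfloor : (⌊(3 : ℝ) ^ n * p⌋₊ : ℝ) ≤ ternarySup A n := mod_cast floor_le_ternarySup hp
    linarith [(hbounds n).1]
  have hleast : ∀ u : unitInterval, u ∈ upperBounds A → r ≤ u := fun u hu =>
    le_of_forall_three_pow fun n => by
      have hsup : ternarySup A n ≤ ⌊(3 : ℝ) ^ n * u⌋₊ := ternarySup_le fun p hp =>
        Nat.floor_le_floor (mul_le_mul_of_nonneg_left (hu hp) (by positivity))
      have hu_le := Nat.floor_le (mul_nonneg (by positivity : (0 : ℝ) ≤ 3 ^ n) u.2.1)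
      have hsup' : (ternarySup A n : ℝ) ≤ ⌊(3 : ℝ) ^ n * u⌋₊ := mod_cast hsup
      linarith [(hbounds n).2]
  have hnonneg : 0 ≤ r := le_of_forall_three_pow fun n => by
    linarith [(hbounds n).1, Nat.cast_nonneg (α := ℝ) (ternarySup A n)]
  exact ⟨⟨r, hnonneg, hleast 1 fun p _ => p.2.2⟩, ⟨hupper, hleast⟩, hr⟩

theorem supOf_fiberCode {Y : unitInterval → ℕ} (hY : Set.InjOn Y A) :
    supOf (unitCode.fiberCode A Y) = fun n => frac (ternarySup A n) (3 ^ n) := by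
  have hfloor : ∀ p ∈ A, ∀ n, ternaryFloor (entry (unitCode.fiberCode A Y (Y p)) 0) n =
      ⌊(3 : ℝ) ^ n * p⌋₊ := fun p hp n => by
    rw [unitCode.fiberCode_apply hY hp, entry_single]
    exact ternaryFloor_eq (codesReal_realName _) p.2.1 n
  refine funext fun n => congrArg (fun s => frac (sInf s) (3 ^ n)) (Set.ext fun k => ?_)
  constructor
  · intro h p hp
    rw [← hfloor p hp]
    exact h (Y p) ((unitCode.fiberCode_ne_zero_iff hY).2 ⟨p, hp, rfl⟩)
  · intro h i hi
    obtain ⟨p, hp, rfl⟩ := (unitCode.fiberCode_ne_zero_iff hY).1 hi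
    rw [hfloor p hp]
    exact h p hp

theorem namesSup_supOf {Y : unitInterval → ℕ} (hY : Set.InjOn Y A) :
    NamesSup A (supOf (unitCode.fiberCode A Y)) := by
  obtain ⟨p, hlub, hp⟩ := exists_isLUB_codesReal_ternarySup A
  exact ⟨p, hlub, supOf_fiberCode hY ▸ hp⟩

end TernarySup

/-! ### The two clusters -/

theorem inCluster_of_le {β τ υ υ' : Ty} {B : Set (Par β)} {C : Set (Par τ)} {lower : Par υ}
    {upper : Par υ'} (hle : ComputableModE2 upper lower)
    (hB : ∀ b ∈ B, ComputableModE2 lower b) (hB' : ∃ b ∈ B, ComputableModE2 b upper)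
    (hC : ∀ c ∈ C, ComputableModE2 lower c) (hC' : ∃ c ∈ C, ComputableModE2 c upper) :
    InCluster B C := by
  obtain ⟨b₀, hb₀, hb₀'⟩ := hB'
  obtain ⟨c₀, hc₀, hc₀'⟩ := hC'
  have hBC : ∀ c ∈ C, ∃ b ∈ B, ComputableModE2 b c := fun c hc =>
    ⟨b₀, hb₀, (hb₀'.trans hle).trans (hC c hc)⟩
  exact ⟨hBC, c₀, hc₀, hBC c₀ hc₀, fun b hb => (hc₀'.trans hle).trans (hB b hb)⟩

theorem exists_mem_omegaOne_le (D : Dom) : ∃ b ∈ OmegaOne D, ComputableModE2 b singletonHub := by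
  refine ⟨(domCode D).setFunctional _ point, (domCode D).setFunctional_mem ?_,
    (domCode D).setFunctional_le_hub isRec_id ?_ fun _ => rfl⟩
  · rintro _ ⟨p, rfl⟩
    refine ⟨p, rfl, ?_⟩
    rw [Set.image_singleton, point_singleton]
    exact (domCode D).names_cname p
  · rintro _ ⟨p, rfl⟩
    exact ⟨_, Set.image_singleton⟩

theorem exists_mem_lists_le {D : Dom} {dom : Set D.Pt → Prop} (hdom : ∀ X, dom X → X.Finite) :
    ∃ b ∈ D.SetFunctional Ty.one dom D.Lists, ComputableModE2 b finiteHub :=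
  ⟨(domCode D).setFunctional dom sortCode,
    (domCode D).setFunctional_mem fun X hX => (domCode D).lists_sortCode (hdom X hX),
    (domCode D).setFunctional_le_hub isRec_id (fun X hX => (hdom X hX).image _) fun _ => rfl⟩

theorem inCluster_omegaOne {τ : Ty} {C : Set (Par τ)} (D : Dom)
    (hC : ∀ c ∈ C, ComputableModE2 bitHub c) (hC' : ∃ c ∈ C, ComputableModE2 c singletonHub) :
    InCluster (OmegaOne D) C :=
  inCluster_of_le singletonHub_le (fun _ => bitHub_le_of_mem_omegaOne) (exists_mem_omegaOne_le D)
    hC hC'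

theorem inCluster_omega {τ : Ty} {C : Set (Par τ)} (D : Dom)
    (hC : ∀ c ∈ C, ComputableModE2 nonemptyHub c) (hC' : ∃ c ∈ C, ComputableModE2 c finiteHub) :
    InCluster (Omega D) C :=
  inCluster_of_le (finiteHub_le.trans subsingletonHub_le)
    (fun _ => nonemptyHub_le_of_mem_lists fun _ h => h)
    (exists_mem_lists_le fun _ h => Set.finite_of_encard_le_coe h) hC hC'

theorem inCluster_omega_lists {D' : Dom} {dom : Set D'.Pt → Prop} (D : Dom)
    (hdom : ∀ X, X.encard ≤ 1 → dom X) (hdom' : ∀ X, dom X → X.Finite) :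
    InCluster (Omega D) (D'.SetFunctional Ty.one dom D'.Lists) :=
  inCluster_omega D (fun _ => nonemptyHub_le_of_mem_lists hdom) (exists_mem_lists_le hdom')

theorem exists_mem_omegaEq_le (n : ℕ) : ∃ b ∈ OmegaEq n, ComputableModE2 b singletonHub := by
  refine ⟨unitCode.setFunctional _ sortCode, unitCode.setFunctional_mem fun _ hX =>
    unitCode.lists_sortCode (Set.finite_of_encard_eq_coe hX), ?_⟩
  refine ComputableModE2.trans (unitCode.setFunctional_le_hub isRec_id ?_ fun _ => rfl)
    (hub_encard_eq_le n)
  exact fun _ hX => (unitCode.cname_injective.encard_image _).trans hX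

theorem exists_mem_omegaCard_le : ∃ b ∈ OmegaCard, ComputableModE2 b finiteHub := by
  refine ⟨unitCode.setFunctional _ fun X => sortCode X 0, unitCode.setFunctional_mem fun X hX => ?_,
    unitCode.setFunctional_le_hub (post := fun s : ℕ → ℕ => s 0)
      (Rec.lam (RecSeq.app Rec.var .zero)) (fun X hX => hX.image _) fun _ => rfl⟩
  rw [← unitCode.cname_injective.encard_image]
  exact encard_eq_sortCode_zero (hX.image _)

theorem omegaCard_subset_omegaCardBound : OmegaCard ⊆ OmegaCardBound := fun _ hΦ G =>
  ⟨fun X hG hX => ((hΦ G).1 X hG hX).imp fun _ h => ⟨h.1, le_of_eq h.2⟩, (hΦ G).2⟩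

theorem sortCode_comp_eq_single_comp_point {F : ℕ → Set (ℕ → ℕ)} (hF : ∀ n, ∃ x, F n = {x}) :
    (fun n => sortCode (F n)) = fun n => single (point (F n)) := by
  funext n
  obtain ⟨x, hx⟩ := hF n
  rw [hx, sortCode_singleton, point_singleton]

theorem exists_mem_weakEnumeration_le :
    ∃ b ∈ WeakEnumerationFunctional, ComputableModE2 b singletonHub :=
  ⟨unitCode.setFunFunctional _ fun F => enumOf fun n => sortCode (F n),
    unitCode.setFunFunctional_mem fun _ _ h => unitCode.enumerates_enumOf h.1,
    unitCode.setFunFunctional_le_hub (isRec_comp_single isRec_enumOf)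
      (fun _ _ h => unitCode.fiberNames_eq_singleton h.1 h.2)
      fun _ hF => congrArg enumOf (sortCode_comp_eq_single_comp_point hF)⟩

theorem exists_mem_weakOmegaBW_le : ∃ b ∈ WeakOmegaBW, ComputableModE2 b singletonHub :=
  ⟨unitCode.setFunFunctional _ fun F => supOf fun n => sortCode (F n),
    unitCode.setFunFunctional_mem fun _ _ h => namesSup_supOf h.1,
    unitCode.setFunFunctional_le_hub (isRec_comp_single isRec_supOf)
      (fun _ _ h => unitCode.fiberNames_eq_singleton h.1 h.2)
      fun _ hF => congrArg supOf (sortCode_comp_eq_single_comp_point hF)⟩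

theorem exists_mem_enumeration_le : ∃ b ∈ EnumerationFunctional, ComputableModE2 b finiteHub :=
  ⟨unitCode.setFunFunctional _ fun F => enumOf fun n => sortCode (F n),
    unitCode.setFunFunctional_mem fun _ _ h => unitCode.enumerates_enumOf h,
    unitCode.setFunFunctional_le_hub isRec_enumOf (fun _ _ h => unitCode.finite_fiberNames h)
      fun _ _ => rfl⟩

theorem exists_mem_omegaBW_le : ∃ b ∈ OmegaBW, ComputableModE2 b finiteHub :=
  ⟨unitCode.setFunFunctional _ fun F => supOf fun n => sortCode (F n),
    unitCode.setFunFunctional_mem fun _ _ h => namesSup_supOf h,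
    unitCode.setFunFunctional_le_hub isRec_supOf (fun _ _ h => unitCode.finite_fiberNames h)
      fun _ _ => rfl⟩

end HigherType

theorem mainTheorem8 (D : HigherType.Dom) :
    ((∀ n : ℕ, 1 ≤ n →
        HigherType.InCluster (HigherType.OmegaOne D) (HigherType.OmegaEq n)) ∧
      HigherType.InCluster (HigherType.OmegaOne D) HigherType.WeakEnumerationFunctional ∧
      HigherType.InCluster (HigherType.OmegaOne D) HigherType.WeakOmegaBW) ∧
    (HigherType.InCluster (HigherType.Omega D) HigherType.OmegaFin ∧
      (∀ n : ℕ, 1 ≤ n →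
        HigherType.InCluster (HigherType.Omega D) (HigherType.OmegaLe n)) ∧
      HigherType.InCluster (HigherType.Omega D) HigherType.OmegaCard ∧
      HigherType.InCluster (HigherType.Omega D) HigherType.OmegaCardBound ∧
      HigherType.InCluster (HigherType.Omega D) HigherType.EnumerationFunctional ∧
      HigherType.InCluster (HigherType.Omega D) HigherType.OmegaBW) := by
  open HigherType in
  refine ⟨⟨fun n hn => ?_, ?_, ?_⟩, ?_, fun n hn => ?_, ?_, ?_, ?_, ?_⟩
  · exact inCluster_omegaOne D (fun _ => bitHub_le_of_mem_omegaEq hn) (exists_mem_omegaEq_le n)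
  · exact inCluster_omegaOne D (fun _ => bitHub_le_of_mem_weakEnumeration)
      exists_mem_weakEnumeration_le
  · exact inCluster_omegaOne D (fun _ => bitHub_le_of_mem_weakOmegaBW) exists_mem_weakOmegaBW_le
  · exact inCluster_omega_lists D (fun _ h => Set.finite_of_encard_le_coe h) fun _ h => h
  · exact inCluster_omega_lists D (fun _ h => h.trans (by exact_mod_cast hn))
      fun _ h => Set.finite_of_encard_le_coe h
  · exact inCluster_omega D
      (fun _ h => nonemptyHub_le_of_mem_omegaCardBound (omegaCard_subset_omegaCardBound h))
      exists_mem_omegaCard_le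
  · obtain ⟨c, hc, h⟩ := exists_mem_omegaCard_le
    exact inCluster_omega D (fun _ => nonemptyHub_le_of_mem_omegaCardBound)
      ⟨c, omegaCard_subset_omegaCardBound hc, h⟩
  · exact inCluster_omega D (fun _ => nonemptyHub_le_of_mem_enumeration) exists_mem_enumeration_le
  · exact inCluster_omega D (fun _ => nonemptyHub_le_of_mem_omegaBW) exists_mem_omegaBW_le
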